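/- For a random vector or matrix, $\|\cdot\|_2$ denotes the Euclidean norm of a vector and the spectral norm of a matrix. (i) There are absolute constants $C, C' > 0$ such that the following holds. Let $N, T \ge 1$ and let $A$ be a random real $N \times T$ matrix with independent rows $a_1, \ldots, a_N \in \mathbb{R}^T$; let $\Sigma := \frac1N \sum_{i=1}^N \mathbb{E}[a_i a_i']$ and $m_p := \big(\mathbb{E} \max_{i \le N} \|a_i\|_2^p\big)^{1/p} \in [0, \infty]$. Then, for every $p \in [2, \infty)$, $$\big(\mathbb{E}\|A\|_2^p\big)^{1/p} \le C \sqrt{N}\, \|\Sigma\|_2^{1/2} + C' \sqrt{p + \log T}\; m_p ,$$ where the right-hand side is read as $\infty$ if $m_p = \infty$ (if $m_p < \infty$, then $\Sigma$ is well defined). (ii) Let $p \ge 2$, $\delta > p$, $C_1, C_2 < \infty$, $0 < C_3 < \infty$, $\varphi > \delta/(\delta - 2)$ and $b > 0$. Let $(N_k)$ and $(T_k)$ be sequences of natural numbers with $N_k, T_k \to \infty$ and $N_k / T_k^b \to C_3$. For each $k$ let $A_k = (a^{(k)}_{it})$ be a random real $N_k \times T_k$ matrix, on a probability space that may depend on $k$,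 with independent rows, such that for all $k, i, t$ one has $\mathbb{E}\, a^{(k)}_{it} = 0$ and $\big(\mathbb{E}|a^{(k)}_{it}|^\delta\big)^{1/\delta} \le C_1$, and such that for all $k$ and $i$ the $\alpha$-mixing coefficients $$\alpha^{(k)}_i(q) := \sup_{t} \ \sup \big\{ |P(B \cap C) - P(B) P(C)| : B \in \sigma(a^{(k)}_{is} : s \le t),\ C \in \sigma(a^{(k)}_{is} : s \ge t + q) \big\}$$ of the $i$-th row (all times ranging over $1, \ldots, T_k$, and $\alpha^{(k)}_i(q) = 0$ for $q \ge T_k$) satisfy $\alpha^{(k)}_i(q) \le C_2\, q^{-\varphi}$ for all integers $q \ge 1$. Then $\mathbb{E}\|A_k\|_2^p < \infty$ for every $k$, and, as $k \to \infty$, $$\big(\mathbb{E}\|A_k\|_2^p\big)^{1/p} = O\big(T_k^{b/2}\big) + O\big(\sqrt{\log T_k}\; T_k^{1/2 + b/p}\big).$$ -/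

import Mathlib

universe u

open MeasureTheory ProbabilityTheory Filter Asymptotics
-- From here on, the norm of a matrix is its spectral norm (the `ℓ²`-operator norm).
open scoped Matrix.Norms.L2Operator

/-- `(E |X|^p)^{1/p}`, as an element of `[0, ∞]`. -/
noncomputable def pMoment {Ω : Type*} [MeasurableSpace Ω] (μ : Measure Ω) (p : ℝ)
    (X : Ω → ℝ) : ENNReal :=
  (∫⁻ ω, ENNReal.ofReal (|X ω| ^ p) ∂μ) ^ (1 / p)

/-- The second moment matrix `Σ = N⁻¹ ∑ᵢ E[aᵢ aᵢ']` of a random matrix with rows `aᵢ`. -/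
noncomputable def secondMomentMatrix {Ω : Type*} [MeasurableSpace Ω] (μ : Measure Ω) {N T : ℕ}
    (A : Ω → Matrix (Fin N) (Fin T) ℝ) : Matrix (Fin T) (Fin T) ℝ :=
  Matrix.of fun s t => (1 / (N : ℝ)) * ∑ i, ∫ ω, A ω i s * A ω i t ∂μ

/-- The largest Euclidean norm of a row of a matrix (with at least one row). -/
noncomputable def maxRowNorm {N T : ℕ} (M : Matrix (Fin N) (Fin T) ℝ) : ℝ :=
  ⨆ i, ‖WithLp.toLp 2 (M i)‖

/-- The σ-algebra generated by `X s`, `s ≤ t`. -/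
abbrev pastSigma {Ω : Type*} {T : ℕ} (X : Fin T → Ω → ℝ) (t : Fin T) : MeasurableSpace Ω :=
  ⨆ s : {s : Fin T // s ≤ t}, MeasurableSpace.comap (X s) inferInstance

/-- The σ-algebra generated by `X s`, `t ≤ s`. -/
abbrev futureSigma {Ω : Type*} {T : ℕ} (X : Fin T → Ω → ℝ) (t : Fin T) : MeasurableSpace Ω :=
  ⨆ s : {s : Fin T // t ≤ s}, MeasurableSpace.comap (X s) inferInstance

/-- The dependence coefficients whose supremum is the `q`-th `α`-mixing coefficient:
`|P(B ∩ C) - P(B) P(C)|` with `B` in the past of a time `t` and `C` in the future of `t + q`. -/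
def alphaMixingSet {Ω : Type*} [MeasurableSpace Ω] (μ : Measure Ω) {T : ℕ}
    (X : Fin T → Ω → ℝ) (q : ℕ) : Set ℝ :=
  {r | ∃ (t u : Fin T) (B C : Set Ω), (u : ℕ) = t + q ∧
    MeasurableSet[pastSigma X t] B ∧ MeasurableSet[futureSigma X u] C ∧
    r = |μ.real (B ∩ C) - μ.real B * μ.real C|}

/-- The `α`-mixing coefficient `α(q)` of the process `X 0, …, X (T - 1)`
(which is `0` for `q ≥ T`, where there is no pair of times at distance `q`). -/
noncomputable def alphaMixingCoeff {Ω : Type*} [MeasurableSpace Ω] (μ : Measure Ω) {T : ℕ}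
    (X : Fin T → Ω → ℝ) (q : ℕ) : ℝ :=
  sSup (alphaMixingSet μ X q)

/-- The supremum defining `α(q)` is one of a bounded set. -/
theorem bddAbove_alphaMixingSet {Ω : Type*} [MeasurableSpace Ω] (μ : Measure Ω)
    [IsProbabilityMeasure μ] {T : ℕ} (X : Fin T → Ω → ℝ) (q : ℕ) :
    BddAbove (alphaMixingSet μ X q) := by
  refine ⟨1, ?_⟩
  rintro r ⟨t, u, B, C, -, -, -, rfl⟩
  have h1 : μ.real (B ∩ C) ≤ 1 := measureReal_le_one
  have h2 : μ.real B ≤ 1 := measureReal_le_one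
  have h3 : μ.real C ≤ 1 := measureReal_le_one
  have p1 : 0 ≤ μ.real (B ∩ C) := measureReal_nonneg
  have p2 : 0 ≤ μ.real B := measureReal_nonneg
  have p3 : 0 ≤ μ.real C := measureReal_nonneg
  rw [abs_le]
  constructor <;> nlinarith

/-! Part (i) is Rudelson's argument. Since `‖A‖² = ‖A'A‖` and `A'A` is a sum of independent rank-one
matrices with mean `N Σ`, it suffices to bound the fluctuation of `A'A` in moment order `p/2`.
Subtracting an independent copy and exchanging rows of the two copies reduces this to the signed
sums `Z = ∑ εᵢ aᵢ aᵢ'`, averaged over all signs. For fixed rows the matrix Khintchine inequality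
bounds them by a multiple of `√(p + log T) · maxᵢ ‖aᵢ‖ · ‖A‖`. After Cauchy–Schwarz, `X =
(E‖A‖^p)^{1/p}` satisfies `X² ≤ N‖Σ‖ + K m_p X` with `K = 8√(p + log T)`, and this is solved for `X`
(`eLpNorm'_norm_le`).

Khintchine itself is a recursion on `E tr Z^{2m}` (`sum_trace_pow_signedGram_le`): expand one factor
`Z`, pair every sign pattern with its flip at `i` (a discrete integration by parts), telescope the
difference of odd powers, and bound the mixed products by a rearrangement inequality. Each step
costs `(2m+1) R² ‖A‖²`; with `m` of order `p + log T` the dimension factor of the trace is harmless.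

Part (ii) inserts `m_p = O(N^{1/p} T^{1/2})` and `‖Σ‖ = O(1)` into (i). The former bounds a maximum
by a sum. For the latter, truncation at a level growing with the lag `q` bounds the autocovariances
by a multiple of `q^{-φ(δ-2)/δ}`, which is summable because `φ > δ/(δ-2)`, and Schur's test applies.
-/

set_option linter.unusedSectionVars false

/-! ### Matrix Khintchine inequality for rank-one summands -/

section Khintchine

variable {ι n : Type*} [Fintype ι] [DecidableEq ι] [Fintype n] [DecidableEq n]

open Matrix

/-- The moments `a' Wᵏ a` of a symmetric matrix are power sums with nonnegative weights. -/
theorem Matrix.IsHermitian.exists_dotProduct_pow_mulVec_eq {W : Matrix n n ℝ}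
    (hW : W.IsHermitian) (a : n → ℝ) :
    ∃ c l : n → ℝ, (∀ j, 0 ≤ c j) ∧ ∀ k : ℕ, a ⬝ᵥ (W ^ k *ᵥ a) = ∑ j, c j * l j ^ k := by
  set U : Matrix n n ℝ := (hW.eigenvectorUnitary : Matrix n n ℝ) with hU
  refine ⟨fun j => (star U *ᵥ a) j ^ 2, hW.eigenvalues, fun j => sq_nonneg _, fun k => ?_⟩
  have h : W ^ k = U * diagonal (fun j => hW.eigenvalues j ^ k) * star U := by
    conv_lhs => rw [hW.spectral_theorem]
    rw [← map_pow, diagonal_pow, Unitary.conjStarAlgAut_apply]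
    rfl
  rw [h, ← mulVec_mulVec, ← mulVec_mulVec, dotProduct_mulVec]
  have h2 : a ᵥ* U = star U *ᵥ a := by
    rw [← mulVec_transpose]
    congr 1
  rw [h2]
  simp only [dotProduct, mulVec_diagonal]
  exact Finset.sum_congr rfl fun j _ => by ring

/-- Rearrangement: `|x|^k - |y|^k` and `|x|^s - |y|^s` have the same sign, so their product is
nonnegative. -/
theorem mul_pow_add_mul_pow_le (x y : ℝ) {k r : ℕ} (hk : k ≤ 2 * r) :
    x ^ k * y ^ (2 * r - k) + x ^ (2 * r - k) * y ^ k ≤ x ^ (2 * r) + y ^ (2 * r) := by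
  obtain ⟨s, hs⟩ := Nat.exists_eq_add_of_le hk
  have hs' : 2 * r - k = s := by omega
  rw [hs']
  have hx : x ^ (2 * r) = |x| ^ k * |x| ^ s := by
    rw [← pow_add, ← hs, (even_two_mul r).pow_abs]
  have hy : y ^ (2 * r) = |y| ^ k * |y| ^ s := by
    rw [← pow_add, ← hs, (even_two_mul r).pow_abs]
  have h1 : x ^ k * y ^ s ≤ |x| ^ k * |y| ^ s := by
    rw [← abs_pow, ← abs_pow, ← abs_mul]; exact le_abs_self _
  have h2 : x ^ s * y ^ k ≤ |x| ^ s * |y| ^ k := by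
    rw [← abs_pow, ← abs_pow, ← abs_mul]; exact le_abs_self _
  rw [hx, hy]
  have h3 : 0 ≤ (|x| ^ k - |y| ^ k) * (|x| ^ s - |y| ^ s) := by
    rcases le_total |x| |y| with h | h
    · exact mul_nonneg_of_nonpos_of_nonpos
        (sub_nonpos.2 (pow_le_pow_left₀ (abs_nonneg _) h _))
        (sub_nonpos.2 (pow_le_pow_left₀ (abs_nonneg _) h _))
    · exact mul_nonneg
        (sub_nonneg.2 (pow_le_pow_left₀ (abs_nonneg _) h _))
        (sub_nonneg.2 (pow_le_pow_left₀ (abs_nonneg _) h _))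
  nlinarith

theorem dotProduct_pow_mulVec_mul_add_le {W Y : Matrix n n ℝ} (hW : W.IsHermitian)
    (hY : Y.IsHermitian) (a : n → ℝ) {k r : ℕ} (hk : k ≤ 2 * r) :
    (a ⬝ᵥ (W ^ k *ᵥ a)) * (a ⬝ᵥ (Y ^ (2 * r - k) *ᵥ a)) +
      (a ⬝ᵥ (W ^ (2 * r - k) *ᵥ a)) * (a ⬝ᵥ (Y ^ k *ᵥ a)) ≤
    (a ⬝ᵥ a) * (a ⬝ᵥ (W ^ (2 * r) *ᵥ a) + a ⬝ᵥ (Y ^ (2 * r) *ᵥ a)) := by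
  obtain ⟨c, l, hc, hl⟩ := hW.exists_dotProduct_pow_mulVec_eq a
  obtain ⟨d, m, hd, hm⟩ := hY.exists_dotProduct_pow_mulVec_eq a
  -- The case `k = 0`: both families of weights have total mass `a ⬝ᵥ a`, so the scalar inequality
  -- can be integrated against their product.
  have e1 : a ⬝ᵥ a = ∑ j, c j := by simpa using hl 0
  have e2 : a ⬝ᵥ a = ∑ j, d j := by simpa using hm 0
  rw [mul_add]
  nth_rw 1 [e2]
  rw [e1, mul_comm (∑ j, d j)]
  simp only [hl, hm, Finset.sum_mul_sum, ← Finset.sum_add_distrib]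
  refine Finset.sum_le_sum fun i _ => Finset.sum_le_sum fun j _ => ?_
  have := mul_le_mul_of_nonneg_left (mul_pow_add_mul_pow_le (l i) (m j) hk)
    (mul_nonneg (hc i) (hd j))
  nlinarith

/-- Adding the sum to its reflection pairs the index `k` with `2r - k`, and every pair obeys the
same bound. -/
theorem sum_dotProduct_pow_mulVec_mul_le {W Y : Matrix n n ℝ} (hW : W.IsHermitian)
    (hY : Y.IsHermitian) (a : n → ℝ) (r : ℕ) :
    2 * ∑ k ∈ Finset.range (2 * r + 1),
      (a ⬝ᵥ (W ^ k *ᵥ a)) * (a ⬝ᵥ (Y ^ (2 * r - k) *ᵥ a)) ≤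
    (2 * r + 1) * ((a ⬝ᵥ a) * (a ⬝ᵥ (W ^ (2 * r) *ᵥ a) + a ⬝ᵥ (Y ^ (2 * r) *ᵥ a))) := by
  have h := Finset.sum_range_reflect
    (fun k => (a ⬝ᵥ (W ^ k *ᵥ a)) * (a ⬝ᵥ (Y ^ (2 * r - k) *ᵥ a))) (2 * r + 1)
  rw [two_mul (Finset.sum _ _)]
  nth_rw 2 [← h]
  rw [← Finset.sum_add_distrib]
  refine (Finset.sum_le_card_nsmul _ _
    ((a ⬝ᵥ a) * (a ⬝ᵥ (W ^ (2 * r) *ᵥ a) + a ⬝ᵥ (Y ^ (2 * r) *ᵥ a))) fun k hk => ?_).trans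
    (le_of_eq ?_)
  · have hk' : k ≤ 2 * r := by have := Finset.mem_range.1 hk; omega
    have e : 2 * r + 1 - 1 - k = 2 * r - k := by omega
    have e' : 2 * r - (2 * r - k) = k := by omega
    simp only [e, e']
    exact dotProduct_pow_mulVec_mul_add_le hW hY a hk'
  · simp

/-- `Wⁿ - Yⁿ` telescopes when `W - Y` is a multiple of `a a'`. -/
theorem dotProduct_pow_sub_pow_mulVec {W Y : Matrix n n ℝ} {a : n → ℝ} {c : ℝ}
    (h : W - Y = c • vecMulVec a a) (m : ℕ) :
    a ⬝ᵥ ((W ^ m - Y ^ m) *ᵥ a) =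
      c * ∑ k ∈ Finset.range m, (a ⬝ᵥ (W ^ k *ᵥ a)) * (a ⬝ᵥ (Y ^ (m - 1 - k) *ᵥ a)) := by
  have tel : ∀ m : ℕ, W ^ m - Y ^ m =
      ∑ k ∈ Finset.range m, W ^ k * (W - Y) * Y ^ (m - 1 - k) := by
    intro m
    induction m with
    | zero => simp
    | succ m ih =>
      rw [Finset.sum_range_succ]
      have : ∑ k ∈ Finset.range m, W ^ k * (W - Y) * Y ^ (m + 1 - 1 - k) =
          (W ^ m - Y ^ m) * Y := by
        rw [ih, Finset.sum_mul]
        refine Finset.sum_congr rfl fun k hk => ?_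
        have : m + 1 - 1 - k = (m - 1 - k) + 1 := by have := Finset.mem_range.1 hk; omega
        rw [this, pow_succ]; simp only [mul_assoc]
      rw [this]
      simp only [Nat.add_sub_cancel, Nat.sub_self, pow_zero, mul_one, pow_succ]
      noncomm_ring
  rw [tel, sum_mulVec, dotProduct_sum, Finset.mul_sum]
  refine Finset.sum_congr rfl fun k _ => ?_
  rw [h, ← mulVec_mulVec, ← mulVec_mulVec, smul_mulVec, mulVec_smul, dotProduct_smul,
    vecMulVec_mulVec]
  simp only [op_smul_eq_smul, mulVec_smul,
    dotProduct_smul, smul_eq_mul]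
  ring

/-- The sign attached to a bit. -/
def bitSign (b : Bool) : ℝ := if b then 1 else -1

@[simp] theorem bitSign_not (b : Bool) : bitSign (!b) = -bitSign b := by
  cases b <;> simp [bitSign]

@[simp] theorem bitSign_mul_self (b : Bool) : bitSign b * bitSign b = 1 := by
  cases b <;> simp [bitSign]

/-- The signed Gram matrix `∑ᵢ εᵢ aᵢ aᵢ'` of the rows of `A`. -/
def signedGram (A : Matrix ι n ℝ) (ε : ι → Bool) : Matrix n n ℝ :=
  ∑ i, bitSign (ε i) • vecMulVec (A i) (A i)

theorem isHermitian_signedGram (A : Matrix ι n ℝ) (ε : ι → Bool) :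
    (signedGram A ε).IsHermitian := by
  refine isSelfAdjoint_sum _ fun i _ => ?_
  rw [isSelfAdjoint_iff, star_smul, star_trivial, star_eq_conjTranspose]
  congr 1
  ext s t
  simp [vecMulVec_apply, mul_comm]

/-- Flipping one sign. -/
def flipAt (i : ι) : Equiv.Perm (ι → Bool) :=
  Function.Involutive.toPerm (fun ε => Function.update ε i (!ε i)) fun ε => by
    ext j
    by_cases h : j = i
    · subst h; simp
    · simp [h]

theorem flipAt_apply (i : ι) (ε : ι → Bool) : flipAt i ε = Function.update ε i (!ε i) := rfl

theorem signedGram_sub_flipAt (A : Matrix ι n ℝ) (ε : ι → Bool) (i : ι) :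
    signedGram A ε - signedGram A (flipAt i ε) =
      (2 * bitSign (ε i)) • vecMulVec (A i) (A i) := by
  unfold signedGram
  rw [← Finset.sum_sub_distrib, Finset.sum_eq_single i]
  · simp only [flipAt_apply, Function.update_self, bitSign_not]
    module
  · intro j _ hj
    simp [flipAt_apply, hj]
  · simp

/-- Discrete integration by parts: the flip at `i` permutes the sign patterns and negates `bitSign
(ε i)`, so twice the left side involves only the difference of the odd powers at `ε` and at its
flip. That difference telescopes, because the two matrices differ by a multiple of `aᵢ aᵢ'`. -/
theorem sum_bitSign_mul_dotProduct_le (A : Matrix ι n ℝ) (i : ι) (r : ℕ) :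
    ∑ ε : ι → Bool, bitSign (ε i) * (A i ⬝ᵥ (signedGram A ε ^ (2 * r + 1) *ᵥ A i)) ≤
      (2 * r + 1) * ((A i ⬝ᵥ A i) *
        ∑ ε : ι → Bool, A i ⬝ᵥ (signedGram A ε ^ (2 * r) *ᵥ A i)) := by
  set Z := signedGram A
  set S := ∑ ε : ι → Bool, bitSign (ε i) * (A i ⬝ᵥ (Z ε ^ (2 * r + 1) *ᵥ A i)) with hS
  have flipS : S = - ∑ ε : ι → Bool,
      bitSign (ε i) * (A i ⬝ᵥ (Z (flipAt i ε) ^ (2 * r + 1) *ᵥ A i)) := by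
    rw [hS, ← Equiv.sum_comp (flipAt i), ← Finset.sum_neg_distrib]
    refine Finset.sum_congr rfl fun ε _ => ?_
    rw [show flipAt i ε i = !ε i by simp [flipAt_apply], bitSign_not, neg_mul]
  have flipM : ∑ ε : ι → Bool, A i ⬝ᵥ (Z (flipAt i ε) ^ (2 * r) *ᵥ A i) =
      ∑ ε : ι → Bool, A i ⬝ᵥ (Z ε ^ (2 * r) *ᵥ A i) :=
    Equiv.sum_comp (flipAt i) fun ε => A i ⬝ᵥ (Z ε ^ (2 * r) *ᵥ A i)
  have key : S + S ≤ (2 * r + 1) * ((A i ⬝ᵥ A i) *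
      ∑ ε : ι → Bool, (A i ⬝ᵥ (Z ε ^ (2 * r) *ᵥ A i) +
        A i ⬝ᵥ (Z (flipAt i ε) ^ (2 * r) *ᵥ A i))) := by
    nth_rw 2 [flipS]
    rw [hS, ← sub_eq_add_neg, ← Finset.sum_sub_distrib, Finset.mul_sum, Finset.mul_sum]
    refine Finset.sum_le_sum fun ε _ => ?_
    refine le_trans (le_of_eq ?_) (sum_dotProduct_pow_mulVec_mul_le
      (isHermitian_signedGram A ε) (isHermitian_signedGram A (flipAt i ε)) (A i) r)
    rw [← mul_sub, ← dotProduct_sub, ← sub_mulVec,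
      dotProduct_pow_sub_pow_mulVec (signedGram_sub_flipAt A ε i), ← mul_assoc]
    -- The sign and the sign in `signedGram_sub_flipAt` multiply to one, leaving the factor 2.
    congr 1
    linear_combination 2 * bitSign_mul_self (ε i)
  rw [Finset.sum_add_distrib, flipM] at key
  linarith

theorem trace_pow_succ_signedGram (A : Matrix ι n ℝ) (ε : ι → Bool) (m : ℕ) :
    (signedGram A ε ^ (m + 1)).trace =
      ∑ i, bitSign (ε i) * (A i ⬝ᵥ (signedGram A ε ^ m *ᵥ A i)) := by
  rw [pow_succ']
  nth_rw 1 [signedGram]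
  rw [Finset.sum_mul, trace_sum]
  refine Finset.sum_congr rfl fun i _ => ?_
  rw [smul_mul, trace_smul, smul_eq_mul, vecMulVec_mul, trace_vecMulVec, dotProduct_comm,
    ← dotProduct_mulVec]

theorem trace_transpose_mul_self_eq (M : Matrix ι n ℝ) :
    (Mᵀ * M).trace = ∑ t, ‖WithLp.toLp 2 (Mᵀ t)‖ ^ 2 := by
  simp only [trace, diag_apply, mul_apply, EuclideanSpace.norm_sq_eq, transpose_apply,
    Real.norm_eq_abs, sq_abs]
  exact Finset.sum_congr rfl fun t _ => Finset.sum_congr rfl fun i _ => by ring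

/-- The spectral norm is at most the Frobenius norm. -/
theorem l2_opNorm_sq_le_trace (M : Matrix ι n ℝ) : ‖M‖ ^ 2 ≤ (Mᵀ * M).trace := by
  have h0 : (Mᵀ * M).trace = ∑ i, ∑ t, M i t ^ 2 := by
    rw [trace_transpose_mul_self_eq, Finset.sum_comm]
    simp [EuclideanSpace.norm_sq_eq]
  have hnn : 0 ≤ (Mᵀ * M).trace := by rw [h0]; positivity
  rw [← Real.le_sqrt (norm_nonneg _) hnn, l2_opNorm_def]
  refine ContinuousLinearMap.opNorm_le_bound _ (Real.sqrt_nonneg _) fun x => ?_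
  refine le_of_sq_le_sq ?_ (by positivity)
  rw [mul_pow, Real.sq_sqrt hnn, EuclideanSpace.norm_sq_eq, EuclideanSpace.norm_sq_eq, h0,
    Finset.sum_mul]
  refine Finset.sum_le_sum fun i _ => ?_
  simpa [mulVec, dotProduct] using
    Finset.sum_mul_sq_le_sq_mul_sq Finset.univ (fun t => M i t) (fun t => x t)

/-- Column by column: the columns of `M * B` are the images under `M` of those of `B`. -/
theorem trace_conj_le (M : Matrix ι n ℝ) (B : Matrix n n ℝ) :
    ((M * B)ᵀ * (M * B)).trace ≤ ‖M‖ ^ 2 * (Bᵀ * B).trace := by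
  rw [trace_transpose_mul_self_eq, trace_transpose_mul_self_eq, Finset.mul_sum]
  refine Finset.sum_le_sum fun t _ => ?_
  rw [← mul_pow]
  refine pow_le_pow_left₀ (norm_nonneg _) ?_ 2
  exact l2_opNorm_mulVec M (WithLp.toLp 2 (Bᵀ t))

theorem pow_two_mul_eq_transpose_mul {W : Matrix n n ℝ} (hW : W.IsHermitian) (r : ℕ) :
    W ^ (2 * r) = (W ^ r)ᵀ * W ^ r := by
  have : (W ^ r)ᵀ = W ^ r := by
    rw [transpose_pow]; congr 1
  rw [this, ← pow_add, two_mul]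

/-- The left side is the squared Frobenius norm of `A * W ^ r`. -/
theorem sum_dotProduct_pow_mulVec_le (A : Matrix ι n ℝ) {W : Matrix n n ℝ} (hW : W.IsHermitian)
    (r : ℕ) :
    ∑ i, A i ⬝ᵥ (W ^ (2 * r) *ᵥ A i) ≤ ‖A‖ ^ 2 * (W ^ (2 * r)).trace := by
  have h := trace_conj_le A (W ^ r)
  rw [trace_mul_comm, ← pow_two_mul_eq_transpose_mul hW] at h
  refine le_trans (le_of_eq ?_) h
  rw [transpose_mul, Matrix.mul_assoc, ← Matrix.mul_assoc (W ^ r), transpose_pow,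
    show Wᵀ = W from hW, ← pow_add, ← two_mul]
  refine Finset.sum_congr rfl fun i _ => ?_
  rw [diag_apply, mul_apply, dotProduct]
  exact Finset.sum_congr rfl fun s _ => rfl

/-- The recursion behind Khintchine: the squared row lengths contribute `R ^ 2`, and the remaining
sum over rows contributes `‖A‖ ^ 2`. -/
theorem sum_trace_pow_signedGram_le (A : Matrix ι n ℝ) {R : ℝ} (hR : ∀ i, A i ⬝ᵥ A i ≤ R ^ 2)
    (m : ℕ) :
    ∑ ε : ι → Bool, (signedGram A ε ^ (2 * (m + 1))).trace ≤
      (2 * m + 1) * (R * ‖A‖) ^ 2 * ∑ ε : ι → Bool, (signedGram A ε ^ (2 * m)).trace := by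
  have e : 2 * (m + 1) = 2 * m + 1 + 1 := by ring
  simp only [e, trace_pow_succ_signedGram]
  rw [Finset.sum_comm]
  calc _ ≤ ∑ i, (2 * m + 1) * (R ^ 2 *
        ∑ ε : ι → Bool, A i ⬝ᵥ (signedGram A ε ^ (2 * m) *ᵥ A i)) := by
        refine Finset.sum_le_sum fun i _ => (sum_bitSign_mul_dotProduct_le A i m).trans ?_
        refine mul_le_mul_of_nonneg_left (mul_le_mul_of_nonneg_right (hR i) ?_) (by positivity)
        refine Finset.sum_nonneg fun ε _ => ?_
        obtain ⟨c, l, hc, hl⟩ :=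
          (isHermitian_signedGram A ε).exists_dotProduct_pow_mulVec_eq (A i)
        rw [hl]
        refine Finset.sum_nonneg fun j _ => mul_nonneg (hc j) ((even_two_mul m).pow_nonneg _)
    _ = (2 * m + 1) * R ^ 2 *
        ∑ ε : ι → Bool, ∑ i, A i ⬝ᵥ (signedGram A ε ^ (2 * m) *ᵥ A i) := by
        rw [Finset.sum_comm, Finset.mul_sum]
        exact Finset.sum_congr rfl fun i _ => by ring
    _ ≤ (2 * m + 1) * R ^ 2 *
        ∑ ε : ι → Bool, ‖A‖ ^ 2 * (signedGram A ε ^ (2 * m)).trace := by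
        refine mul_le_mul_of_nonneg_left (Finset.sum_le_sum fun ε _ => ?_) (by positivity)
        exact sum_dotProduct_pow_mulVec_le A (isHermitian_signedGram A ε) m
    _ = _ := by rw [← Finset.mul_sum]; ring

/-- The matrix Khintchine inequality for sums of rank-one matrices, in trace form. -/
theorem sum_trace_pow_signedGram_le_pow (A : Matrix ι n ℝ) {R : ℝ}
    (hR : ∀ i, A i ⬝ᵥ A i ≤ R ^ 2) {m k : ℕ} (hk : k ≤ m) :
    ∑ ε : ι → Bool, (signedGram A ε ^ (2 * k)).trace ≤
      (2 * m) ^ k * (R * ‖A‖) ^ (2 * k) * (2 ^ Fintype.card ι * Fintype.card n) := by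
  induction k with
  | zero => simp
  | succ k ih =>
    refine (sum_trace_pow_signedGram_le A hR k).trans ?_
    have h1 : (2 * k + 1 : ℝ) ≤ 2 * m := by
      have : ((k + 1 : ℕ) : ℝ) ≤ m := by exact_mod_cast hk
      push_cast at this; linarith
    calc _ ≤ (2 * m) * (R * ‖A‖) ^ 2 * ((2 * m) ^ k * (R * ‖A‖) ^ (2 * k) *
            (2 ^ Fintype.card ι * Fintype.card n)) := by
          refine (mul_le_mul_of_nonneg_left (ih (by omega)) (by positivity)).trans ?_
          refine mul_le_mul_of_nonneg_right (mul_le_mul_of_nonneg_right h1 (by positivity)) ?_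
          have : 0 ≤ (R * ‖A‖) ^ (2 * k) := (even_two_mul k).pow_nonneg _
          positivity
      _ = _ := by ring

/-- For a self-adjoint matrix the norm commutes with powers `2 ^ j`; the further square comes from
comparing spectral and Frobenius norms. -/
theorem norm_signedGram_pow_le_trace (A : Matrix ι n ℝ) (ε : ι → Bool) (j : ℕ) :
    ‖signedGram A ε‖ ^ (2 * 2 ^ j) ≤ (signedGram A ε ^ (2 * 2 ^ j)).trace := by
  have h := isHermitian_signedGram A ε
  have h' : IsSelfAdjoint (signedGram A ε) := h
  rw [mul_comm 2, pow_mul, ← h'.norm_pow_two_pow, mul_comm, pow_two_mul_eq_transpose_mul h]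
  exact l2_opNorm_sq_le_trace _

/-- The matrix Khintchine inequality for sums of rank-one matrices. -/
theorem sum_norm_signedGram_rpow_le [Nonempty n] (A : Matrix ι n ℝ) {R : ℝ} (hR0 : 0 ≤ R)
    (hR : ∀ i, A i ⬝ᵥ A i ≤ R ^ 2) {q L : ℝ} (hq : 0 < q) (hqL : q ≤ L) (hL : 1 ≤ L)
    (hnL : Real.log (Fintype.card n) ≤ L) :
    ∑ ε : ι → Bool, ‖signedGram A ε‖ ^ q ≤
      2 ^ Fintype.card ι * (4 * Real.sqrt L * (R * ‖A‖)) ^ q := by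
  obtain ⟨j', hj1, hj2⟩ := exists_nat_pow_near hL (one_lt_two : (1 : ℝ) < 2)
  set m : ℕ := 2 ^ (j' + 1) with hm
  have hmR : (m : ℝ) = 2 ^ (j' + 1) := by simp [hm]
  have hLm : L ≤ m := by rw [hmR]; exact hj2.le
  have hmL : (m : ℝ) ≤ 2 * L := by rw [hmR, pow_succ]; linarith
  have hm0 : (0 : ℝ) < m := by linarith
  have hcard : (Fintype.card (ι → Bool) : ℝ) = 2 ^ Fintype.card ι := by simp
  set c : ℝ := 2 ^ Fintype.card ι with hc
  have hc0 : 0 < c := by positivity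
  -- The dimension is at most `e ^ m` because `log n ≤ L ≤ m`, and `2 m e ≤ 16 L` from `m ≤ 2 L` and
  -- `e ≤ 4`; this is the source of the constant 4.
  have hK : (2 * m : ℝ) ^ m * Fintype.card n ≤ (4 * Real.sqrt L) ^ (2 * m) := by
    have h1 : (Fintype.card n : ℝ) ≤ Real.exp 1 ^ m := by
      rw [← Real.exp_nat_mul, mul_one, ← Real.log_le_iff_le_exp (by positivity)]
      linarith
    have h2 : (4 * Real.sqrt L) ^ (2 * m) = (16 * L) ^ m := by
      rw [pow_mul, mul_pow, Real.sq_sqrt (by linarith)]; norm_num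
    rw [h2]
    calc (2 * m : ℝ) ^ m * Fintype.card n ≤ (2 * m) ^ m * Real.exp 1 ^ m := by gcongr
      _ = (2 * m * Real.exp 1) ^ m := by simp only [mul_pow]
      _ ≤ (16 * L) ^ m := by
        have := Real.exp_one_lt_d9
        have : Real.exp 1 ≤ 4 := by linarith
        refine pow_le_pow_left₀ (by positivity) ?_ m
        nlinarith
  have hB : 0 ≤ 4 * Real.sqrt L * (R * ‖A‖) := by positivity
  -- Jensen over the uniform signs passes from order `q` to order `2m`.
  have hjen := Real.rpow_arith_mean_le_arith_mean_rpow Finset.univ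
    (fun _ : ι → Bool => c⁻¹) (fun ε => ‖signedGram A ε‖ ^ q) (fun _ _ => by positivity)
    (by rw [Finset.sum_const, Finset.card_univ, nsmul_eq_mul, hcard]
        exact mul_inv_cancel₀ hc0.ne')
    (fun _ _ => by positivity) (p := 2 * m / q) (by rw [le_div_iff₀ hq]; linarith)
  rw [← Finset.mul_sum, ← Finset.mul_sum] at hjen
  have hpow : ∀ x : ℝ, 0 ≤ x → (x ^ q) ^ (2 * m / q) = x ^ (2 * m) := fun x hx => by
    rw [← Real.rpow_mul hx, mul_div_cancel₀ _ hq.ne', ← Real.rpow_natCast]; push_cast; rfl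
  rw [← inv_mul_le_iff₀ hc0, ← Real.rpow_le_rpow_iff (z := 2 * m / q) (by positivity)
    (by positivity) (by positivity), hpow _ hB]
  refine hjen.trans ?_
  rw [inv_mul_le_iff₀ hc0]
  calc ∑ ε : ι → Bool, (‖signedGram A ε‖ ^ q) ^ (2 * m / q)
      ≤ ∑ ε : ι → Bool, (signedGram A ε ^ (2 * m)).trace := by
        refine Finset.sum_le_sum fun ε _ => ?_
        rw [hpow _ (norm_nonneg _)]
        exact norm_signedGram_pow_le_trace A ε (j' + 1)
    _ ≤ (2 * m) ^ m * (R * ‖A‖) ^ (2 * m) * (c * Fintype.card n) :=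
        sum_trace_pow_signedGram_le_pow A hR le_rfl
    _ = c * ((2 * m : ℝ) ^ m * Fintype.card n * (R * ‖A‖) ^ (2 * m)) := by ring
    _ ≤ c * ((4 * Real.sqrt L) ^ (2 * m) * (R * ‖A‖) ^ (2 * m)) := by gcongr
    _ = _ := by rw [mul_pow (4 * Real.sqrt L)]

end Khintchine

/-! ### Moments as `eLpNorm'`, and their transport to the law -/

section Moments

theorem pMoment_eq_eLpNorm' {Ω : Type*} [MeasurableSpace Ω] (μ : Measure Ω) {p : ℝ} (hp : 0 ≤ p)
    (X : Ω → ℝ) : pMoment μ p X = eLpNorm' X p μ := by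
  unfold pMoment eLpNorm'
  congr 1
  refine lintegral_congr fun ω => ?_
  rw [← ENNReal.ofReal_rpow_of_nonneg (abs_nonneg _) hp, ← Real.norm_eq_abs,
    ofReal_norm]

theorem pMoment_map {Ω E : Type*} [MeasurableSpace Ω] [MeasurableSpace E] {μ : Measure Ω}
    {p : ℝ} {g : Ω → E} (hg : Measurable g) {X : E → ℝ} (hX : Measurable X) :
    pMoment (μ.map g) p X = pMoment μ p (X ∘ g) := by
  unfold pMoment
  rw [lintegral_map (by fun_prop) hg]
  rfl

end Moments

/-! ### Symmetrization and Rudelson's inequality -/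

section Symmetrization

open Matrix

variable {N T : ℕ}

/-- The Gram matrix `∑ᵢ aᵢ aᵢ'` of the rows of `A`. -/
def rowGram (A : Matrix (Fin N) (Fin T) ℝ) : Matrix (Fin T) (Fin T) ℝ := Aᵀ * A

theorem norm_rowGram (A : Matrix (Fin N) (Fin T) ℝ) : ‖rowGram A‖ = ‖A‖ ^ 2 := by
  rw [sq]; exact l2_opNorm_conjTranspose_mul_self A

theorem rowGram_eq_sum (A : Matrix (Fin N) (Fin T) ℝ) : rowGram A = ∑ i, vecMulVec (A i) (A i) := by
  ext s t
  simp [rowGram, mul_apply, Matrix.sum_apply, vecMulVec_apply]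

theorem maxRowNorm_nonneg (A : Matrix (Fin N) (Fin T) ℝ) : 0 ≤ maxRowNorm A :=
  Real.iSup_nonneg fun _ => norm_nonneg _

theorem norm_row_le_maxRowNorm (A : Matrix (Fin N) (Fin T) ℝ) (i : Fin N) :
    ‖WithLp.toLp 2 (A i)‖ ≤ maxRowNorm A :=
  le_ciSup (f := fun i => ‖WithLp.toLp 2 (A i)‖) (Set.finite_range _).bddAbove i

theorem dotProduct_row_le (A : Matrix (Fin N) (Fin T) ℝ) (i : Fin N) :
    A i ⬝ᵥ A i ≤ maxRowNorm A ^ 2 := by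
  refine le_trans (le_of_eq ?_) (pow_le_pow_left₀ (norm_nonneg _) (norm_row_le_maxRowNorm A i) 2)
  rw [EuclideanSpace.norm_sq_eq]
  simp only [dotProduct, Real.norm_eq_abs, sq_abs, ← sq]

theorem norm_sq_le_sum_row (A : Matrix (Fin N) (Fin T) ℝ) : ‖A‖ ^ 2 ≤ ∑ i, A i ⬝ᵥ A i := by
  refine (l2_opNorm_sq_le_trace A).trans (le_of_eq ?_)
  rw [trace_mul_comm]
  rfl

theorem norm_le_sqrt_mul_maxRowNorm (A : Matrix (Fin N) (Fin T) ℝ) :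
    ‖A‖ ≤ Real.sqrt N * maxRowNorm A := by
  refine le_of_sq_le_sq ?_ (mul_nonneg (Real.sqrt_nonneg _) (maxRowNorm_nonneg A))
  rw [mul_pow, Real.sq_sqrt (Nat.cast_nonneg _)]
  refine (norm_sq_le_sum_row A).trans ?_
  refine (Finset.sum_le_card_nsmul _ _ _ fun i _ => dotProduct_row_le A i).trans (le_of_eq ?_)
  simp

theorem continuous_norm_matrix : Continuous fun x : Fin N → Fin T → ℝ => ‖(of x)‖ := by
  have : Continuous fun x : Fin N → Fin T → ℝ => of x := by fun_prop
  exact this.norm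

theorem measurable_maxRowNorm : Measurable fun x : Fin N → Fin T → ℝ => maxRowNorm (of x) := by
  unfold maxRowNorm
  refine Measurable.iSup fun i => ?_
  have : Continuous fun x : Fin N → Fin T → ℝ => ‖WithLp.toLp 2 (x i)‖ := by fun_prop
  exact this.measurable

theorem continuous_rowGram : Continuous fun x : Fin N → Fin T → ℝ => rowGram (of x) := by
  unfold rowGram
  have : Continuous fun x : Fin N → Fin T → ℝ => of x := by fun_prop
  exact this.matrix_transpose.matrix_mul this

theorem continuous_signedGram (ε : Fin N → Bool) :
    Continuous fun x : Fin N → Fin T → ℝ => signedGram (of x) ε := by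
  unfold signedGram
  refine continuous_finsetSum _ fun i _ => ?_
  have : Continuous fun x : Fin N → Fin T → ℝ => x i := continuous_apply i
  exact (this.matrix_vecMulVec this).const_smul (bitSign (ε i))

/-- Exchange the rows `i` with `ε i = false` of two matrices. -/
def swapRows {E : Type*} (ε : Fin N → Bool) (z : (Fin N → E) × (Fin N → E)) :
    (Fin N → E) × (Fin N → E) :=
  (fun i => if ε i then z.1 i else z.2 i, fun i => if ε i then z.2 i else z.1 i)

/-- Regarded as a family of independent pairs with laws `νᵢ ⊗ νᵢ`, the two matrices are changed only
by swaps inside some pairs, each of which preserves its law. -/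
theorem measurePreserving_swapRows {E : Type*} [MeasurableSpace E] (ε : Fin N → Bool)
    (ν : Fin N → Measure E) [∀ i, IsProbabilityMeasure (ν i)] :
    MeasurePreserving (swapRows ε) ((Measure.pi ν).prod (Measure.pi ν))
      ((Measure.pi ν).prod (Measure.pi ν)) := by
  have h1 := measurePreserving_arrowProdEquivProdArrow E E (Fin N) ν ν
  have h2 : MeasurePreserving (fun (x : Fin N → E × E) i => if ε i then x i else (x i).swap)
      (Measure.pi fun i => (ν i).prod (ν i)) (Measure.pi fun i => (ν i).prod (ν i)) := by
    refine measurePreserving_pi _ _ (f := fun i (z : E × E) => if ε i then z else z.swap) fun i => ?_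
    cases ε i
    · exact Measure.measurePreserving_swap
    · exact MeasurePreserving.id _
  have h3 := (h1.comp h2).comp (h1.symm _)
  convert h3 using 1
  funext z
  refine Prod.ext (funext fun i => ?_) (funext fun i => ?_) <;>
  · cases h : ε i <;>
    simp [swapRows, MeasurableEquiv.arrowProdEquivProdArrow, Equiv.arrowProdEquivProdArrow, h]

theorem rowGram_sub_rowGram_swapRows (ε : Fin N → Bool)
    (z : (Fin N → Fin T → ℝ) × (Fin N → Fin T → ℝ)) :
    rowGram (of (swapRows ε z).1) - rowGram (of (swapRows ε z).2) =
      signedGram (of z.1) ε - signedGram (of z.2) ε := by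
  rw [rowGram_eq_sum, rowGram_eq_sum]
  unfold signedGram
  rw [← Finset.sum_sub_distrib, ← Finset.sum_sub_distrib]
  refine Finset.sum_congr rfl fun i _ => ?_
  have e1 : of (swapRows ε z).1 i = if ε i then z.1 i else z.2 i := rfl
  have e2 : of (swapRows ε z).2 i = if ε i then z.2 i else z.1 i := rfl
  have e3 : of z.1 i = z.1 i := rfl
  have e4 : of z.2 i = z.2 i := rfl
  rw [e1, e2, e3, e4]
  cases ε i <;> simp [bitSign]
  abel

theorem two_rpow_sub_one_mul_two (q : ℝ) : (2 : ENNReal) ^ (q - 1) * 2 = 2 ^ q := by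
  nth_rw 2 [← ENNReal.rpow_one 2]
  rw [← ENNReal.rpow_add _ _ two_ne_zero ENNReal.ofNat_ne_top, sub_add_cancel]

variable (ν : Fin N → Measure (Fin T → ℝ)) [∀ i, IsProbabilityMeasure (ν i)]

/-- For each fixed sign pattern, exchanging rows leaves the law unchanged and inserts the signs;
convexity then separates the two copies. -/
theorem lintegral_rowGram_sub_rowGram_le_signedGram {q : ℝ} (hq : 1 ≤ q) (ε : Fin N → Bool) :
    ∫⁻ z, ‖rowGram (of z.1) - rowGram (of z.2)‖ₑ ^ q ∂((Measure.pi ν).prod (Measure.pi ν)) ≤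
      2 ^ q * ∫⁻ x, ‖signedGram (of x) ε‖ₑ ^ q ∂(Measure.pi ν) := by
  have hm : Measurable fun x : Fin N → Fin T → ℝ => ‖signedGram (of x) ε‖ₑ ^ q :=
    (continuous_signedGram ε).enorm.measurable.pow_const q
  have hm2 : Measurable fun z : (Fin N → Fin T → ℝ) × (Fin N → Fin T → ℝ) =>
      ‖rowGram (of z.1) - rowGram (of z.2)‖ₑ ^ q :=
    ((continuous_rowGram.comp continuous_fst).sub
      (continuous_rowGram.comp continuous_snd)).enorm.measurable.pow_const q
  rw [← (measurePreserving_swapRows ε ν).lintegral_comp hm2]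
  simp only [rowGram_sub_rowGram_swapRows]
  calc _ ≤ ∫⁻ z, 2 ^ (q - 1) * (‖signedGram (of z.1) ε‖ₑ ^ q + ‖signedGram (of z.2) ε‖ₑ ^ q)
        ∂((Measure.pi ν).prod (Measure.pi ν)) := by
        refine lintegral_mono fun z => ?_
        refine (ENNReal.rpow_le_rpow enorm_sub_le (by linarith)).trans ?_
        exact ENNReal.rpow_add_le_mul_rpow_add_rpow _ _ hq
    _ = 2 ^ (q - 1) * (∫⁻ z, ‖signedGram (of z.1) ε‖ₑ ^ q
          ∂((Measure.pi ν).prod (Measure.pi ν)) + ∫⁻ z, ‖signedGram (of z.2) ε‖ₑ ^ q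
          ∂((Measure.pi ν).prod (Measure.pi ν))) := by
        have h1 : Measurable fun z : (Fin N → Fin T → ℝ) × (Fin N → Fin T → ℝ) =>
          ‖signedGram (of z.1) ε‖ₑ ^ q := hm.comp measurable_fst
        have h2 : Measurable fun z : (Fin N → Fin T → ℝ) × (Fin N → Fin T → ℝ) =>
          ‖signedGram (of z.2) ε‖ₑ ^ q := hm.comp measurable_snd
        rw [lintegral_const_mul' _ _ (by finiteness), lintegral_add_left h1]
    _ = _ := by
        rw [measurePreserving_fst.lintegral_comp hm, measurePreserving_snd.lintegral_comp hm,
          ← two_rpow_sub_one_mul_two q]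
        ring

/-- The previous bound is summed over all `2 ^ N` sign patterns, so that Khintchine applies
pointwise in the rows. -/
theorem lintegral_rowGram_sub_rowGram_le (hT : 1 ≤ T) {q L : ℝ} (hq : 1 ≤ q) (hqL : q ≤ L)
    (hTL : Real.log T ≤ L) :
    ∫⁻ z, ‖rowGram (of z.1) - rowGram (of z.2)‖ₑ ^ q ∂((Measure.pi ν).prod (Measure.pi ν)) ≤
      2 ^ q * ∫⁻ x, ENNReal.ofReal ((4 * Real.sqrt L * (maxRowNorm (of x) * ‖of x‖)) ^ q)
        ∂(Measure.pi ν) := by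
  have : Nonempty (Fin T) := ⟨⟨0, hT⟩⟩
  have hm : ∀ ε, Measurable fun x : Fin N → Fin T → ℝ => ‖signedGram (of x) ε‖ₑ ^ q :=
    fun ε => (continuous_signedGram ε).enorm.measurable.pow_const q
  set I := ∫⁻ z, ‖rowGram (of z.1) - rowGram (of z.2)‖ₑ ^ q ∂((Measure.pi ν).prod (Measure.pi ν))
  have hsum : (2 : ENNReal) ^ N * I ≤
      2 ^ q * ∫⁻ x, ∑ ε, ‖signedGram (of x) ε‖ₑ ^ q ∂(Measure.pi ν) := by
    rw [lintegral_finsetSum _ fun ε _ => hm ε, Finset.mul_sum]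
    calc (2 : ENNReal) ^ N * I = ∑ _ε : Fin N → Bool, I := by simp
      _ ≤ _ := Finset.sum_le_sum fun ε _ => lintegral_rowGram_sub_rowGram_le_signedGram ν hq ε
  have hpt : ∀ x : Fin N → Fin T → ℝ, ∑ ε, ‖signedGram (of x) ε‖ₑ ^ q ≤
      2 ^ N * ENNReal.ofReal ((4 * Real.sqrt L * (maxRowNorm (of x) * ‖of x‖)) ^ q) := by
    intro x
    have h := sum_norm_signedGram_rpow_le (of x) (maxRowNorm_nonneg (of x))
      (dotProduct_row_le (of x)) (by linarith) hqL (by linarith) (by simpa using hTL)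
    have h' := ENNReal.ofReal_le_ofReal h
    rw [ENNReal.ofReal_sum_of_nonneg fun _ _ => by positivity,
      ENNReal.ofReal_mul (by positivity)] at h'
    refine le_trans (le_of_eq ?_) (h'.trans (le_of_eq ?_))
    · refine Finset.sum_congr rfl fun ε _ => ?_
      rw [← ENNReal.ofReal_rpow_of_nonneg (norm_nonneg _) (by linarith), ofReal_norm]
    · rw [ENNReal.ofReal_pow (by norm_num)]
      simp
  have h2 : (2 : ENNReal) ^ N * I ≤ 2 ^ N * (2 ^ q *
      ∫⁻ x, ENNReal.ofReal ((4 * Real.sqrt L * (maxRowNorm (of x) * ‖of x‖)) ^ q)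
        ∂(Measure.pi ν)) := by
    refine hsum.trans ?_
    rw [mul_left_comm]
    refine mul_le_mul_right ?_ _
    refine (lintegral_mono hpt).trans (le_of_eq ?_)
    rw [lintegral_const_mul']
    simp
  exact (ENNReal.mul_le_mul_iff_right (by simp) (by simp)).1 h2

/-- Cauchy–Schwarz; this puts the unknown moment of `‖A‖` on the right-hand side, to the first
power. -/
theorem lintegral_maxRowNorm_mul_norm_rpow_le (μ : Measure (Fin N → Fin T → ℝ)) {q K : ℝ}
    (hq : 1 ≤ q) (hK : 0 ≤ K) :
    (∫⁻ x, ENNReal.ofReal ((K * (maxRowNorm (of x) * ‖of x‖)) ^ q) ∂μ) ^ (1 / q) ≤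
      ENNReal.ofReal K * (eLpNorm' (fun x => maxRowNorm (of x)) (2 * q) μ *
        eLpNorm' (fun x => ‖of x‖) (2 * q) μ) := by
  have hq0 : 0 < q := by linarith
  have hpt : ∀ x : Fin N → Fin T → ℝ,
      ENNReal.ofReal ((K * (maxRowNorm (of x) * ‖of x‖)) ^ q) =
        ENNReal.ofReal K ^ q * (‖maxRowNorm (of x)‖ₑ ^ q * ‖‖of x‖‖ₑ ^ q) := by
    intro x
    have := maxRowNorm_nonneg (of x)
    rw [← ENNReal.ofReal_rpow_of_nonneg (by positivity) hq0.le, ENNReal.ofReal_mul hK,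
      ENNReal.ofReal_mul this, ENNReal.mul_rpow_of_nonneg _ _ hq0.le,
      ENNReal.mul_rpow_of_nonneg _ _ hq0.le, Real.enorm_of_nonneg this,
      Real.enorm_of_nonneg (norm_nonneg _)]
  simp only [hpt]
  rw [lintegral_const_mul' _ _ (by finiteness), ENNReal.mul_rpow_of_nonneg _ _ (by positivity),
    one_div, ENNReal.rpow_rpow_inv hq0.ne']
  refine mul_le_mul_right ?_ _
  have hR : Measurable fun x : Fin N → Fin T → ℝ => ‖maxRowNorm (of x)‖ₑ ^ q :=
    measurable_maxRowNorm.enorm.pow_const q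
  have hX : Measurable fun x : Fin N → Fin T → ℝ => ‖‖of x‖‖ₑ ^ q :=
    continuous_norm_matrix.measurable.enorm.pow_const q
  have h := ENNReal.lintegral_mul_le_Lp_mul_Lq μ Real.HolderConjugate.two_two
    hR.aemeasurable hX.aemeasurable
  refine (ENNReal.rpow_le_rpow h (by positivity)).trans (le_of_eq ?_)
  rw [ENNReal.mul_rpow_of_nonneg _ _ (by positivity)]
  simp only [eLpNorm', ← ENNReal.rpow_mul]
  have e1 : 1 / 2 * q⁻¹ = 1 / (2 * q) := by field_simp
  rw [e1, mul_comm q 2]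

theorem eLpNorm'_rowGram (μ : Measure (Fin N → Fin T → ℝ)) {q : ℝ} (hq : 1 ≤ q) :
    eLpNorm' (fun x => rowGram (of x)) q μ = eLpNorm' (fun x => ‖of x‖) (2 * q) μ ^ 2 := by
  have hq0 : 0 < q := by linarith
  unfold eLpNorm'
  rw [← ENNReal.rpow_natCast, ← ENNReal.rpow_mul]
  have e1 : 1 / (2 * q) * (2 : ℕ) = 1 / q := by push_cast; field_simp
  rw [e1]
  congr 1
  refine lintegral_congr fun x => ?_
  rw [← ofReal_norm, norm_rowGram, ENNReal.ofReal_pow (norm_nonneg _), ENNReal.rpow_mul,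
    Real.enorm_of_nonneg (norm_nonneg _)]
  norm_num

/-- A crude a priori bound: finiteness is required before the quadratic inequality can be solved. -/
theorem eLpNorm'_norm_lt_top {μ : Measure (Fin N → Fin T → ℝ)} {p : ℝ} (hp : 0 < p)
    (h : eLpNorm' (fun x => maxRowNorm (of x)) p μ < ⊤) :
    eLpNorm' (fun x => ‖of x‖) p μ < ⊤ := by
  have h1 : eLpNorm' (fun x => ‖of x‖) p μ ≤
      eLpNorm' (fun x => Real.sqrt N * maxRowNorm (of x)) p μ := by
    refine eLpNorm'_mono_ae hp.le (ae_of_all _ fun x => ?_)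
    rw [Real.norm_of_nonneg (norm_nonneg _)]
    exact (norm_le_sqrt_mul_maxRowNorm (of x)).trans (le_abs_self _)
  refine h1.trans_lt ?_
  have := eLpNorm'_const_smul_le (μ := μ) (c := Real.sqrt N)
    (f := fun x : Fin N → Fin T → ℝ => maxRowNorm (of x)) hp
  have e : (fun x : Fin N → Fin T → ℝ => Real.sqrt N * maxRowNorm (of x)) =
    Real.sqrt N • fun x => maxRowNorm (of x) := rfl
  rw [e]
  exact this.trans_lt (by finiteness)

theorem eLpNorm'_rowGram_sub_integral_le (hT : 1 ≤ T) {q L : ℝ} (hq : 1 ≤ q) (hqL : q ≤ L)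
    (hTL : Real.log T ≤ L)
    (hint : Integrable (fun x => rowGram (of x)) (Measure.pi ν)) :
    eLpNorm' (fun x => rowGram (of x) - ∫ y, rowGram (of y) ∂(Measure.pi ν)) q (Measure.pi ν) ≤
      ENNReal.ofReal (8 * Real.sqrt L) *
        (eLpNorm' (fun x => maxRowNorm (of x)) (2 * q) (Measure.pi ν) *
          eLpNorm' (fun x => ‖of x‖) (2 * q) (Measure.pi ν)) := by
  have hq0 : 0 < q := by linarith
  set P := Measure.pi ν with hP
  -- Jensen in the independent copy `y`, which stands in for the mean.
  have hpt : ∀ x : Fin N → Fin T → ℝ, ‖rowGram (of x) - ∫ y, rowGram (of y) ∂P‖ₑ ^ q ≤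
      ∫⁻ y, ‖rowGram (of x) - rowGram (of y)‖ₑ ^ q ∂P := by
    intro x
    have h1 : rowGram (of x) - ∫ y, rowGram (of y) ∂P =
        ∫ y, (rowGram (of x) - rowGram (of y)) ∂P := by
      rw [integral_sub (integrable_const _) hint]; simp
    have hmeas : AEStronglyMeasurable (fun y => rowGram (of x) - rowGram (of y)) P :=
      (continuous_const.sub continuous_rowGram).aestronglyMeasurable
    have h2 := eLpNorm'_le_eLpNorm'_of_exponent_le one_pos hq P hmeas
    have h3 : ‖rowGram (of x) - ∫ y, rowGram (of y) ∂P‖ₑ ≤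
        eLpNorm' (fun y => rowGram (of x) - rowGram (of y)) q P := by
      refine le_trans ?_ h2
      rw [h1]
      simpa [eLpNorm'] using
        enorm_integral_le_lintegral_enorm (fun y => rowGram (of x) - rowGram (of y))
    refine (ENNReal.rpow_le_rpow h3 hq0.le).trans (le_of_eq ?_)
    rw [eLpNorm', one_div, ENNReal.rpow_inv_rpow hq0.ne']
  have hm2 : Measurable fun z : (Fin N → Fin T → ℝ) × (Fin N → Fin T → ℝ) =>
      ‖rowGram (of z.1) - rowGram (of z.2)‖ₑ ^ q :=
    ((continuous_rowGram.comp continuous_fst).sub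
      (continuous_rowGram.comp continuous_snd)).enorm.measurable.pow_const q
  have h4 : ∫⁻ x, ‖rowGram (of x) - ∫ y, rowGram (of y) ∂P‖ₑ ^ q ∂P ≤
      2 ^ q * ∫⁻ x, ENNReal.ofReal ((4 * Real.sqrt L * (maxRowNorm (of x) * ‖of x‖)) ^ q) ∂P := by
    refine (lintegral_mono hpt).trans ?_
    rw [← lintegral_prod _ hm2.aemeasurable]
    exact lintegral_rowGram_sub_rowGram_le ν hT hq hqL hTL
  unfold eLpNorm'
  refine (ENNReal.rpow_le_rpow h4 (by positivity)).trans ?_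
  rw [ENNReal.mul_rpow_of_nonneg _ _ (by positivity), one_div, ENNReal.rpow_rpow_inv hq0.ne',
    ← one_div]
  refine (mul_le_mul_right (lintegral_maxRowNorm_mul_norm_rpow_le P hq
    (by positivity : 0 ≤ 4 * Real.sqrt L)) _).trans (le_of_eq ?_)
  rw [← mul_assoc]
  congr 1
  rw [show (8 : ℝ) * Real.sqrt L = 2 * (4 * Real.sqrt L) by ring,
    ENNReal.ofReal_mul (p := 2) (by norm_num)]
  simp

/-- Rudelson's inequality for a random matrix with independent rows. -/
theorem eLpNorm'_norm_le (hT : 1 ≤ T) {p : ℝ} (hp : 2 ≤ p)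
    (hR : eLpNorm' (fun x => maxRowNorm (of x)) p (Measure.pi ν) < ⊤) :
    Integrable (fun x => rowGram (of x)) (Measure.pi ν) ∧
    eLpNorm' (fun x => ‖of x‖) p (Measure.pi ν) ≤
      ENNReal.ofReal (Real.sqrt ‖∫ x, rowGram (of x) ∂(Measure.pi ν)‖) +
      ENNReal.ofReal (8 * Real.sqrt (p + Real.log T)) *
        eLpNorm' (fun x => maxRowNorm (of x)) p (Measure.pi ν) := by
  set P := Measure.pi ν with hP
  -- Moments of order `q` of the Gram matrix are moments of order `2 * q` of `‖A‖`.
  obtain ⟨q, rfl⟩ : ∃ q, p = 2 * q := ⟨p / 2, by ring⟩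
  have hq : 1 ≤ q := by linarith
  have hq0 : 0 < q := by linarith
  have hlog : 0 ≤ Real.log T := Real.log_natCast_nonneg T
  have hX := eLpNorm'_norm_lt_top (by linarith) hR
  have hmeas : AEStronglyMeasurable (fun x : Fin N → Fin T → ℝ => rowGram (of x)) P :=
    continuous_rowGram.aestronglyMeasurable
  have hG : eLpNorm' (fun x => rowGram (of x)) q P < ⊤ := by
    rw [eLpNorm'_rowGram P hq]; finiteness
  have hint : Integrable (fun x => rowGram (of x)) P := by
    rw [← memLp_one_iff_integrable]
    refine ⟨hmeas, ?_⟩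
    rw [eLpNorm_one_eq_lintegral_enorm]
    refine lt_of_le_of_lt ?_ hG
    simpa [eLpNorm'] using eLpNorm'_le_eLpNorm'_of_exponent_le one_pos hq P hmeas
  refine ⟨hint, ?_⟩
  set E := ∫ x, rowGram (of x) ∂P with hE
  have h1 := eLpNorm'_rowGram_sub_integral_le ν (L := 2 * q + Real.log T) hT hq (by linarith)
    (by linarith) hint
  have h2 : eLpNorm' (fun x => rowGram (of x)) q P ≤
      eLpNorm' (fun x => rowGram (of x) - E) q P + ‖E‖ₑ := by
    have h3 := eLpNorm'_add_le (μ := P) (f := fun x : Fin N → Fin T → ℝ => rowGram (of x) - E)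
      (g := fun _ => E) (hmeas.sub aestronglyMeasurable_const) aestronglyMeasurable_const hq
    rw [eLpNorm'_const E hq0] at h3
    have e : ((fun x : Fin N → Fin T → ℝ => rowGram (of x) - E) + fun _ => E) =
      fun x => rowGram (of x) := by funext x; simp
    simpa [e] using h3
  rw [eLpNorm'_rowGram P hq] at h2
  have h4 := h2.trans (add_le_add_left h1 _)
  generalize eLpNorm' (fun x => ‖of x‖) (2 * q) P = X at *
  generalize eLpNorm' (fun x => maxRowNorm (of x)) (2 * q) P = m at *
  set K := 8 * Real.sqrt (2 * q + Real.log T) with hK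
  have hK0 : 0 ≤ K := by positivity
  lift X to NNReal using hX.ne
  lift m to NNReal using hR.ne
  rw [← ofReal_norm] at h4
  have h5 : (X : ℝ) ^ 2 ≤ K * (m * X) + ‖E‖ := by
    have h6 := ENNReal.toReal_mono (by finiteness) h4
    rw [ENNReal.toReal_add (by finiteness) (by finiteness), ENNReal.toReal_mul,
      ENNReal.toReal_ofReal hK0, ENNReal.toReal_ofReal (norm_nonneg _)] at h6
    simpa using h6
  -- If `X` exceeded `√‖E‖ + K m`, then `X (X - K m)` would exceed `‖E‖`.
  have h7 : (X : ℝ) ≤ Real.sqrt ‖E‖ + K * m := by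
    by_contra! hlt
    have hs := Real.sq_sqrt (norm_nonneg E)
    have hs0 := Real.sqrt_nonneg ‖E‖
    have hKm : 0 ≤ K * (m : ℝ) := by positivity
    nlinarith
  have h8 := ENNReal.ofReal_le_ofReal h7
  rwa [ENNReal.ofReal_add (by positivity) (by positivity), ENNReal.ofReal_mul hK0,
    ENNReal.ofReal_coe_nnreal, ENNReal.ofReal_coe_nnreal] at h8

theorem integral_rowGram_eq {P : Measure (Fin N → Fin T → ℝ)}
    (hint : Integrable (fun x => rowGram (of x)) P) (s t : Fin T) :
    (∫ x, rowGram (of x) ∂P) s t = ∑ i, ∫ x, x i s * x i t ∂P := by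
  have happ : ∀ s t : Fin T, ∀ M : Matrix (Fin T) (Fin T) ℝ,
      LinearMap.toContinuousLinearMap (entryLinearMap ℝ ℝ s t) M = M s t := fun _ _ _ => rfl
  -- The diagonal entries give integrability of the squares, which dominate the products `x i s * x
  -- i t`.
  have hent : ∀ s : Fin T, Integrable (fun x : Fin N → Fin T → ℝ => ∑ i, x i s ^ 2) P := by
    intro s
    have := (LinearMap.toContinuousLinearMap (entryLinearMap ℝ ℝ s s)).integrable_comp hint
    refine this.congr (ae_of_all _ fun x => ?_)
    simp only [happ]
    rw [rowGram, mul_apply]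
    exact Finset.sum_congr rfl fun i _ => (sq (x i s)).symm
  have hcomm := ContinuousLinearMap.integral_comp_comm
    (LinearMap.toContinuousLinearMap (entryLinearMap ℝ ℝ s t)) hint
  rw [happ s t] at hcomm
  rw [← hcomm]
  simp only [happ]
  rw [← integral_finsetSum]
  · refine integral_congr_ae (ae_of_all _ fun x => ?_)
    simp only
    rw [rowGram, mul_apply]
    rfl
  · intro i _
    refine ((hent s).add (hent t)).mono' (by fun_prop) (ae_of_all _ fun x => ?_)
    have h1 := Finset.single_le_sum (f := fun i => x i s ^ 2) (fun _ _ => sq_nonneg _)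
      (Finset.mem_univ i)
    have h2 := Finset.single_le_sum (f := fun i => x i t ^ 2) (fun _ _ => sq_nonneg _)
      (Finset.mem_univ i)
    simp only [Pi.add_apply, Real.norm_eq_abs, abs_mul] at h1 h2 ⊢
    nlinarith [sq_abs (x i s), sq_abs (x i t), sq_nonneg (|x i s| - |x i t|)]

/-- The moment bound for the spectral norm of a random matrix with independent rows. -/
theorem pMoment_norm_le (hN : 1 ≤ N) (hT : 1 ≤ T) {Ω : Type*} [MeasurableSpace Ω]
    (μ : Measure Ω) [IsProbabilityMeasure μ] (A : Ω → Matrix (Fin N) (Fin T) ℝ)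
    (hA : ∀ i t, Measurable fun ω => A ω i t)
    (hind : iIndepFun (fun (i : Fin N) (ω : Ω) => (A ω i : Fin T → ℝ)) μ)
    {p : ℝ} (hp : 2 ≤ p) :
    pMoment μ p (fun ω => ‖A ω‖) ≤
      ENNReal.ofReal (Real.sqrt N * ‖secondMomentMatrix μ A‖ ^ (1 / 2 : ℝ)) +
      ENNReal.ofReal (8 * Real.sqrt (p + Real.log T)) *
        pMoment μ p (fun ω => maxRowNorm (A ω)) := by
  have hrow : ∀ i, Measurable fun ω => (A ω i : Fin T → ℝ) := fun i =>
    measurable_pi_lambda _ fun t => hA i t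
  set g : Ω → Fin N → Fin T → ℝ := fun ω i => A ω i with hg
  have hgm : Measurable g := measurable_pi_lambda _ hrow
  have hprob : ∀ i, IsProbabilityMeasure (μ.map fun ω => (A ω i : Fin T → ℝ)) := fun i =>
    Measure.isProbabilityMeasure_map (hrow i).aemeasurable
  have hmap := (iIndepFun_iff_map_fun_eq_pi_map fun i => (hrow i).aemeasurable).1 hind
  have e1 := pMoment_map (p := p) (μ := μ) hgm (continuous_norm_matrix (N := N) (T := T)).measurable
  have e2 := pMoment_map (p := p) (μ := μ) hgm (measurable_maxRowNorm (N := N) (T := T))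
  have hp0 : 0 ≤ p := by linarith
  rw [pMoment_eq_eLpNorm' _ hp0] at e1 e2
  change _ = pMoment μ p (fun ω => ‖A ω‖) at e1
  change _ = pMoment μ p (fun ω => maxRowNorm (A ω)) at e2
  rw [← e1, ← e2]
  -- If `m_p` is infinite, so is the right side, its coefficient being positive.
  by_cases hR : eLpNorm' (fun x => maxRowNorm (of x)) p (μ.map g) = ⊤
  · have hlog : 0 ≤ Real.log T := Real.log_natCast_nonneg T
    rw [hR, ENNReal.mul_top]
    · simp
    · have : 0 < 8 * Real.sqrt (p + Real.log T) := by
        have := Real.sqrt_pos.2 (by linarith : 0 < p + Real.log T)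
        positivity
      simpa using this
  rw [hmap] at hR
  obtain ⟨hint, hmain⟩ := eLpNorm'_norm_le _ hT hp (lt_top_iff_ne_top.2 hR)
  rw [← hmap] at hint hmain
  have hsig : ∫ x, rowGram (of x) ∂(μ.map g) = (N : ℝ) • secondMomentMatrix μ A := by
    ext s t
    have hN' : (N : ℝ) ≠ 0 := by positivity
    rw [integral_rowGram_eq hint, Matrix.smul_apply, secondMomentMatrix, of_apply, smul_eq_mul,
      one_div, mul_inv_cancel_left₀ hN']
    refine Finset.sum_congr rfl fun i _ => ?_
    rw [integral_map hgm.aemeasurable (by fun_prop)]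
  change eLpNorm' _ p (μ.map g) ≤ _ at hmain
  rw [hsig, norm_smul, Real.norm_natCast, Real.sqrt_mul (Nat.cast_nonneg _)] at hmain
  rwa [← Real.sqrt_eq_rpow]

end Symmetrization

/-! ### Covariance inequalities under mixing -/

section Covariance

variable {Ω : Type*} {m : MeasurableSpace Ω}

/-- Two measures that are close on superlevel sets have close integrals. -/
theorem abs_integral_sub_integral_le_of_superlevel {μ₁ μ₂ : Measure Ω} [IsFiniteMeasure μ₁]
    [IsFiniteMeasure μ₂] {g : Ω → ℝ} (hg : Measurable g) {M a : ℝ} (hM : 0 ≤ M)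
    (h0 : ∀ ω, 0 ≤ g ω) (h1 : ∀ ω, g ω ≤ M)
    (h : ∀ t, |μ₁.real {ω | t ≤ g ω} - μ₂.real {ω | t ≤ g ω}| ≤ a) :
    |∫ ω, g ω ∂μ₁ - ∫ ω, g ω ∂μ₂| ≤ a * M := by
  have hint : ∀ (μ : Measure Ω) [IsFiniteMeasure μ], Integrable g μ := fun μ _ =>
    Integrable.of_bound hg.aestronglyMeasurable M
      (ae_of_all _ fun ω => by rw [Real.norm_of_nonneg (h0 ω)]; exact h1 ω)
  -- Layer-cake formula: both integrals are integrals over `(0, M]` of superlevel masses, which are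
  -- monotone and hence integrable.
  have hanti : ∀ (μ : Measure Ω) [IsFiniteMeasure μ],
      IntegrableOn (fun t => μ.real {ω | t ≤ g ω}) (Set.Ioc 0 M) := fun μ _ => by
    have : Antitone fun t => μ.real {ω | t ≤ g ω} := fun s t hst =>
      measureReal_mono fun ω (hω : t ≤ g ω) => hst.trans hω
    exact (this.antitoneOn (Set.Icc 0 M)).integrableOn_isCompact isCompact_Icc |>.mono_set
      Set.Ioc_subset_Icc_self
  rw [(hint μ₁).integral_eq_integral_Ioc_meas_le (ae_of_all _ h0) (ae_of_all _ h1),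
    (hint μ₂).integral_eq_integral_Ioc_meas_le (ae_of_all _ h0) (ae_of_all _ h1),
    ← integral_sub (hanti μ₁) (hanti μ₂), ← Real.norm_eq_abs]
  refine (norm_setIntegral_le_of_norm_le_const (by simp) fun t _ => h t).trans ?_
  simp [hM]

variable {μ : Measure Ω} [IsProbabilityMeasure μ]

/-- Compares the restriction of `μ` to `C` with the multiple of `μ` of the same total mass. -/
theorem abs_setIntegral_sub_le {f : Ω → ℝ} (hf : Measurable f) {M a : ℝ} (hM : 0 ≤ M)
    (h0 : ∀ ω, 0 ≤ f ω) (h1 : ∀ ω, f ω ≤ M) {C : Set Ω}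
    (h : ∀ t, |μ.real ({ω | t ≤ f ω} ∩ C) - μ.real {ω | t ≤ f ω} * μ.real C| ≤ a) :
    |∫ ω in C, f ω ∂μ - μ.real C * ∫ ω, f ω ∂μ| ≤ a * M := by
  have h2 := abs_integral_sub_integral_le_of_superlevel (μ₁ := μ.restrict C)
    (μ₂ := (μ.real C).toNNReal • μ) hf hM h0 h1 (a := a) fun t => by
      have := h t
      rw [measureReal_restrict_apply (measurableSet_le measurable_const hf),
        measureReal_nnreal_smul_apply, Real.coe_toNNReal _ measureReal_nonneg, mul_comm (μ.real C)]
      exact this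
  rwa [integral_smul_nnreal_measure, NNReal.smul_def, Real.coe_toNNReal _ measureReal_nonneg,
    smul_eq_mul] at h2

/-- The same comparison a second time, now between `μ` with density `f` and `(∫ f) μ`; the set
version supplies its hypothesis. -/
theorem abs_integral_mul_sub_le_of_nonneg {f g : Ω → ℝ} (hf : Measurable f) (hg : Measurable g)
    {M a : ℝ} (hM : 0 ≤ M) (f0 : ∀ ω, 0 ≤ f ω) (f1 : ∀ ω, f ω ≤ M)
    (g0 : ∀ ω, 0 ≤ g ω) (g1 : ∀ ω, g ω ≤ M)
    (h : ∀ s t, |μ.real ({ω | s ≤ f ω} ∩ {ω | t ≤ g ω}) -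
      μ.real {ω | s ≤ f ω} * μ.real {ω | t ≤ g ω}| ≤ a) :
    |∫ ω, f ω * g ω ∂μ - (∫ ω, f ω ∂μ) * ∫ ω, g ω ∂μ| ≤ a * M * M := by
  have hI : 0 ≤ ∫ ω, f ω ∂μ := integral_nonneg f0
  have hint : Integrable f μ := Integrable.of_bound hf.aestronglyMeasurable M
      (ae_of_all _ fun ω => by rw [Real.norm_of_nonneg (f0 ω)]; exact f1 ω)
  have hfin : IsFiniteMeasure (μ.withDensity fun ω => ENNReal.ofReal (f ω)) :=
    isFiniteMeasure_withDensity_ofReal hint.2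
  have h2 := abs_integral_sub_integral_le_of_superlevel
    (μ₁ := μ.withDensity fun ω => ENNReal.ofReal (f ω))
    (μ₂ := (∫ ω, f ω ∂μ).toNNReal • μ) hg hM g0 g1 (a := a * M) fun t => by
      have := abs_setIntegral_sub_le (μ := μ) hf hM f0 f1 (C := {ω | t ≤ g ω}) fun s => h s t
      rw [measureReal_nnreal_smul_apply, Real.coe_toNNReal _ hI, mul_comm (∫ ω, f ω ∂μ),
        measureReal_def, withDensity_apply _ (measurableSet_le measurable_const hg),
        ← integral_eq_lintegral_of_nonneg_ae (ae_of_all _ f0) hf.aestronglyMeasurable]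
      exact this
  rw [integral_smul_nnreal_measure, NNReal.smul_def, Real.coe_toNNReal _ hI, smul_eq_mul,
    integral_withDensity_eq_integral_toReal_smul hf.ennreal_ofReal
      (ae_of_all _ fun _ => ENNReal.ofReal_lt_top)] at h2
  simpa only [ENNReal.toReal_ofReal (f0 _), smul_eq_mul] using h2

/-- The covariance inequality for bounded random variables. -/
theorem abs_integral_mul_sub_le_of_abs_le {f g : Ω → ℝ} (hf : Measurable f) (hg : Measurable g)
    {M a : ℝ} (hM : 0 ≤ M) (f1 : ∀ ω, |f ω| ≤ M) (g1 : ∀ ω, |g ω| ≤ M)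
    (h : ∀ s t, |μ.real ({ω | s ≤ f ω} ∩ {ω | t ≤ g ω}) -
      μ.real {ω | s ≤ f ω} * μ.real {ω | t ≤ g ω}| ≤ a) :
    |∫ ω, f ω * g ω ∂μ - (∫ ω, f ω ∂μ) * ∫ ω, g ω ∂μ| ≤ 4 * a * M ^ 2 := by
  have hfi : Integrable f μ := Integrable.of_bound hf.aestronglyMeasurable M (ae_of_all _ f1)
  have hgi : Integrable g μ := Integrable.of_bound hg.aestronglyMeasurable M (ae_of_all _ g1)
  have hfg : Integrable (fun ω => f ω * g ω) μ :=
    hgi.bdd_mul hf.aestronglyMeasurable (ae_of_all _ f1)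
  -- Adding `M` moves both variables into `[0, 2M]` without changing the covariance; `(2M)²` yields
  -- the factor 4.
  have key := abs_integral_mul_sub_le_of_nonneg (μ := μ) (f := fun ω => f ω + M)
    (g := fun ω => g ω + M) (hf.add_const M) (hg.add_const M) (M := 2 * M) (a := a) (by positivity)
    (fun ω => by linarith [neg_le_of_abs_le (f1 ω)]) (fun ω => by linarith [le_of_abs_le (f1 ω)])
    (fun ω => by linarith [neg_le_of_abs_le (g1 ω)]) (fun ω => by linarith [le_of_abs_le (g1 ω)])
    fun s t => by simpa only [sub_le_iff_le_add] using h (s - M) (t - M)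
  have e1 : ∫ ω, (f ω + M) * (g ω + M) ∂μ =
      ∫ ω, f ω * g ω ∂μ + M * ∫ ω, f ω ∂μ + M * ∫ ω, g ω ∂μ + M ^ 2 := by
    have : ∀ ω, (f ω + M) * (g ω + M) = f ω * g ω + M * f ω + M * g ω + M ^ 2 :=
      fun ω => by ring
    simp only [this]
    rw [integral_add (by fun_prop) (by fun_prop), integral_add (by fun_prop) (by fun_prop),
      integral_add (by fun_prop) (by fun_prop), integral_const_mul, integral_const_mul]
    simp
  have e2 : ∫ ω, f ω + M ∂μ = ∫ ω, f ω ∂μ + M := by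
    rw [integral_add hfi (integrable_const _)]; simp
  have e3 : ∫ ω, g ω + M ∂μ = ∫ ω, g ω ∂μ + M := by
    rw [integral_add hgi (integrable_const _)]; simp
  rw [e1, e2, e3] at key
  refine (le_of_eq ?_).trans (key.trans (le_of_eq ?_))
  · congr 1; ring
  · ring

/-- Truncation of a real number at level `M`. -/
noncomputable def clip (M x : ℝ) : ℝ := max (-M) (min x M)

theorem measurable_clip (M : ℝ) : Measurable (clip M) := by unfold clip; fun_prop

theorem abs_clip_le {M : ℝ} (hM : 0 ≤ M) (x : ℝ) : |clip M x| ≤ M := by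
  unfold clip
  rw [abs_le]
  exact ⟨le_max_left _ _, max_le (by linarith) (min_le_right _ _)⟩

theorem abs_sub_clip_le {M : ℝ} (hM : 0 < M) (x : ℝ) {δ k : ℝ} (hk : 0 < k) (hδ : k ≤ δ) :
    |x - clip M x| ^ k ≤ |x| ^ δ * M ^ (k - δ) := by
  by_cases hx : |x| ≤ M
  · have : clip M x = x := by
      unfold clip
      rw [min_eq_left (le_of_abs_le hx), max_eq_right (neg_le_of_abs_le hx)]
    rw [this, sub_self, abs_zero, Real.zero_rpow hk.ne']
    positivity
  · push Not at hx
    have hx0 : 0 < |x| := hM.trans hx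
    have h1 : |x - clip M x| ≤ |x| := by
      unfold clip
      rcases abs_cases x with ⟨h, h'⟩ | ⟨h, h'⟩
      · rw [min_eq_right (by linarith), max_eq_right (by linarith), abs_of_nonneg (by linarith)]
        linarith
      · rw [min_eq_left (by linarith), max_eq_left (by linarith), abs_of_nonpos (by linarith)]
        linarith
    calc |x - clip M x| ^ k ≤ |x| ^ k := Real.rpow_le_rpow (abs_nonneg _) h1 hk.le
      _ = |x| ^ δ * |x| ^ (k - δ) := by rw [← Real.rpow_add hx0]; congr 1; ring
      _ ≤ |x| ^ δ * M ^ (k - δ) := by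
        refine mul_le_mul_of_nonneg_left ?_ (by positivity)
        exact Real.rpow_le_rpow_of_nonpos hM hx.le (by linarith)

theorem abs_mul_sub_clip_mul_clip_le {M : ℝ} (hM : 0 < M) (x y : ℝ) {δ : ℝ} (hδ : 2 ≤ δ) :
    |x * y - clip M x * clip M y| ≤ 3 / 2 * M ^ (2 - δ) * (|x| ^ δ + |y| ^ δ) := by
  have hx := abs_clip_le hM.le x
  have hy := abs_clip_le hM.le y
  have x1 := abs_sub_clip_le hM x one_pos (by linarith : 1 ≤ δ)
  have y1 := abs_sub_clip_le hM y one_pos (by linarith : 1 ≤ δ)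
  have x2 := abs_sub_clip_le hM x two_pos hδ
  have y2 := abs_sub_clip_le hM y two_pos hδ
  rw [Real.rpow_one] at x1 y1
  rw [Real.rpow_two] at x2 y2
  have hMM : M * M ^ (1 - δ) = M ^ (2 - δ) := by
    nth_rw 1 [← Real.rpow_one M]
    rw [← Real.rpow_add hM]; congr 1; ring
  set u := x - clip M x
  set v := y - clip M y
  -- Two cross terms and the product of the two tails; the last is split by the arithmetic-geometric
  -- mean, whence `3/2 = 1 + 1/2`.
  have e : x * y - clip M x * clip M y = clip M x * v + u * clip M y + u * v := by
    simp only [u, v]; ring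
  have h1 : |clip M x * v| ≤ |y| ^ δ * M ^ (2 - δ) := by
    rw [abs_mul, ← hMM]
    calc _ ≤ M * (|y| ^ δ * M ^ (1 - δ)) := mul_le_mul hx y1 (abs_nonneg _) hM.le
      _ = _ := by ring
  have h2 : |u * clip M y| ≤ |x| ^ δ * M ^ (2 - δ) := by
    rw [abs_mul, ← hMM]
    calc _ ≤ (|x| ^ δ * M ^ (1 - δ)) * M := mul_le_mul x1 hy (abs_nonneg _) (by positivity)
      _ = _ := by ring
  have h3 : |u * v| ≤ (|x| ^ δ * M ^ (2 - δ) + |y| ^ δ * M ^ (2 - δ)) / 2 := by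
    rw [abs_mul]; nlinarith [sq_nonneg (|u| - |v|)]
  rw [e]
  refine (abs_add_le _ _).trans ((add_le_add_left (abs_add_le _ _) _).trans ?_)
  linarith

/-- A covariance inequality for centred variables with moments of order `δ`, at a truncation
level `M`. -/
theorem abs_integral_mul_le_of_moment {f g : Ω → ℝ} (hf : Measurable f) (hg : Measurable g)
    {M a δ D : ℝ} (hM : 0 < M) (hδ : 2 ≤ δ)
    (fi : Integrable (fun ω => |f ω| ^ δ) μ) (gi : Integrable (fun ω => |g ω| ^ δ) μ)
    (fD : ∫ ω, |f ω| ^ δ ∂μ ≤ D) (gD : ∫ ω, |g ω| ^ δ ∂μ ≤ D)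
    (f0 : ∫ ω, f ω ∂μ = 0)
    (h : ∀ B C, MeasurableSet[MeasurableSpace.comap f inferInstance] B →
      MeasurableSet[MeasurableSpace.comap g inferInstance] C →
      |μ.real (B ∩ C) - μ.real B * μ.real C| ≤ a) :
    |∫ ω, f ω * g ω ∂μ| ≤ 4 * a * M ^ 2 + 4 * D * M ^ (2 - δ) := by
  have hfc : Measurable fun ω => clip M (f ω) := (measurable_clip M).comp hf
  have hgc : Measurable fun ω => clip M (g ω) := (measurable_clip M).comp hg
  have hfci : Integrable (fun ω => clip M (f ω)) μ :=
    Integrable.of_bound hfc.aestronglyMeasurable M (ae_of_all _ fun ω => abs_clip_le hM.le _)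
  have hgci : Integrable (fun ω => clip M (g ω)) μ :=
    Integrable.of_bound hgc.aestronglyMeasurable M (ae_of_all _ fun ω => abs_clip_le hM.le _)
  have hcc : Integrable (fun ω => clip M (f ω) * clip M (g ω)) μ :=
    hgci.bdd_mul hfc.aestronglyMeasurable (ae_of_all _ fun ω => abs_clip_le hM.le _)
  have hdom : Integrable (fun ω => 3 / 2 * M ^ (2 - δ) * (|f ω| ^ δ + |g ω| ^ δ)) μ :=
    (fi.add gi).const_mul _
  have hdiff : Integrable (fun ω => f ω * g ω - clip M (f ω) * clip M (g ω)) μ :=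
    hdom.mono' (by fun_prop)
      (ae_of_all _ fun ω => abs_mul_sub_clip_mul_clip_le hM (f ω) (g ω) hδ)
  have hcov := abs_integral_mul_sub_le_of_abs_le (μ := μ) hfc hgc hM.le
    (fun ω => abs_clip_le hM.le _) (fun ω => abs_clip_le hM.le _) (a := a) fun s t =>
      h _ _ ⟨clip M ⁻¹' Set.Ici s, measurable_clip M measurableSet_Ici, rfl⟩
        ⟨clip M ⁻¹' Set.Ici t, measurable_clip M measurableSet_Ici, rfl⟩
  have h1 : |∫ ω, (f ω * g ω - clip M (f ω) * clip M (g ω)) ∂μ| ≤ 3 * D * M ^ (2 - δ) := by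
    have := norm_integral_le_of_norm_le
      (f := fun ω => f ω * g ω - clip M (f ω) * clip M (g ω)) hdom
      (ae_of_all _ fun ω => abs_mul_sub_clip_mul_clip_le hM (f ω) (g ω) hδ)
    rw [integral_const_mul, integral_add fi gi, Real.norm_eq_abs] at this
    refine this.trans ?_
    have hMp : 0 ≤ M ^ (2 - δ) := by positivity
    nlinarith
  -- As `f` is centred, the mean of its truncation is minus the mean of the discarded tail.
  have h2 : |∫ ω, clip M (f ω) ∂μ| ≤ D * M ^ (1 - δ) := by
    have hd : ∀ ω, ‖f ω - clip M (f ω)‖ ≤ |f ω| ^ δ * M ^ (1 - δ) := fun ω => by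
      simpa using abs_sub_clip_le hM (f ω) one_pos (by linarith : 1 ≤ δ)
    have hdi : Integrable (fun ω => f ω - clip M (f ω)) μ :=
      (fi.mul_const _).mono' (by fun_prop) (ae_of_all _ hd)
    have h3 := norm_integral_le_of_norm_le (fi.mul_const (M ^ (1 - δ))) (ae_of_all _ hd)
    have hfi : Integrable f μ := (hdi.add hfci).congr (ae_of_all _ fun ω => by simp)
    rw [integral_sub hfi hfci, f0, zero_sub, norm_neg, integral_mul_const] at h3
    exact h3.trans (mul_le_mul_of_nonneg_right fD (by positivity))
  have h3 : |∫ ω, clip M (g ω) ∂μ| ≤ M := by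
    simpa using norm_integral_le_of_norm_le_const (μ := μ)
      (f := fun ω => clip M (g ω))
      (ae_of_all _ fun ω => abs_clip_le hM.le (g ω))
  have h4 : |(∫ ω, clip M (f ω) ∂μ) * ∫ ω, clip M (g ω) ∂μ| ≤ D * M ^ (2 - δ) := by
    rw [abs_mul]
    refine (mul_le_mul h2 h3 (abs_nonneg _) ((abs_nonneg _).trans h2)).trans (le_of_eq ?_)
    rw [mul_assoc]; congr 1
    nth_rw 2 [← Real.rpow_one M]
    rw [← Real.rpow_add hM]; congr 1; ring
  have h5 : ∫ ω, f ω * g ω ∂μ = ∫ ω, (f ω * g ω - clip M (f ω) * clip M (g ω)) ∂μ +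
      ∫ ω, clip M (f ω) * clip M (g ω) ∂μ := by
    rw [← integral_add hdiff hcc]; simp
  rw [h5]
  rw [abs_le] at *
  constructor <;> linarith [h1.1, h1.2, hcov.1, hcov.2, h4.1, h4.2]

end Covariance

/-! ### Schur's test and sums over lags -/

section Schur

open Matrix

/-- Schur's test for symmetric matrices. -/
theorem norm_le_of_row_sum_le {n : Type*} [Fintype n] [DecidableEq n] {S : Matrix n n ℝ}
    (hS : ∀ s t, S s t = S t s) {B : ℝ} (hB : 0 ≤ B) (h : ∀ s, ∑ t, |S s t| ≤ B) : ‖S‖ ≤ B := by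
  rw [l2_opNorm_def]
  refine ContinuousLinearMap.opNorm_le_bound _ hB fun x => ?_
  refine le_of_sq_le_sq ?_ (by positivity)
  rw [mul_pow, EuclideanSpace.norm_sq_eq, EuclideanSpace.norm_sq_eq]
  -- Cauchy–Schwarz with the weights `|S s t|`; symmetry later turns column sums into row sums.
  have h1 : ∀ s, (∑ t, S s t * x t) ^ 2 ≤ B * ∑ t, |S s t| * x t ^ 2 := by
    intro s
    refine (Finset.sum_sq_le_sum_mul_sum_of_sq_le_mul Finset.univ (f := fun t => |S s t|)
      (g := fun t => |S s t| * x t ^ 2) (fun _ _ => abs_nonneg _) (fun _ _ => by positivity)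
      fun t _ => ?_).trans ?_
    · rw [mul_pow, ← sq_abs (S s t)]; exact le_of_eq (by ring)
    · exact mul_le_mul_of_nonneg_right (h s) (Finset.sum_nonneg fun _ _ => by positivity)
  calc _ = ∑ s, (∑ t, S s t * x t) ^ 2 := by
        refine Finset.sum_congr rfl fun s _ => ?_
        rw [Real.norm_eq_abs, sq_abs]; rfl
    _ ≤ ∑ s, B * ∑ t, |S s t| * x t ^ 2 := Finset.sum_le_sum fun s _ => h1 s
    _ = B * ∑ t, x t ^ 2 * ∑ s, |S t s| := by
        rw [← Finset.mul_sum, Finset.sum_comm]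
        congr 1
        refine Finset.sum_congr rfl fun t _ => ?_
        rw [Finset.mul_sum]
        exact Finset.sum_congr rfl fun s _ => by rw [hS s t]; ring
    _ ≤ B * ∑ t, x t ^ 2 * B := by
        refine mul_le_mul_of_nonneg_left (Finset.sum_le_sum fun t _ => ?_) hB
        exact mul_le_mul_of_nonneg_left (h t) (sq_nonneg _)
    _ = _ := by
        rw [← Finset.sum_mul]
        simp only [Real.norm_eq_abs, sq_abs]
        ring

/-- On each side of `s` the distance to `s` is injective, so each lag occurs at most twice. -/
theorem sum_natDist_le_two_mul_tsum {T : ℕ} (s : Fin T) {c : ℕ → ℝ} (hc : ∀ q, 0 ≤ c q)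
    (hs : Summable c) : ∑ t : Fin T, c (Nat.dist s t) ≤ 2 * ∑' q, c q := by
  have hle : ∀ F : Finset (Fin T), Set.InjOn (fun t : Fin T => Nat.dist s t) F →
      ∑ t ∈ F, c (Nat.dist s t) ≤ ∑' q, c q := fun F hF => by
    rw [← Finset.sum_image (f := c) hF]
    exact hs.sum_le_tsum _ fun q _ => hc q
  rw [← Finset.sum_filter_add_sum_filter_not Finset.univ fun t => t ≤ s, two_mul]
  refine add_le_add (hle _ ?_) (hle _ ?_)
  · intro t ht u hu htu
    simp only [Finset.coe_filter, Finset.mem_univ, true_and, Set.mem_ofPred_eq, Fin.le_def] at ht hu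
    simp only [Nat.dist] at htu
    exact Fin.ext (by omega)
  · intro t ht u hu htu
    simp only [Finset.coe_filter, Finset.mem_univ, true_and, Set.mem_ofPred_eq, Fin.le_def] at ht hu
    simp only [Nat.dist] at htu
    exact Fin.ext (by omega)

end Schur

/-! ### Moments of the largest row norm -/

section Rows

variable {Ω : Type*} [MeasurableSpace Ω] {μ : Measure Ω}

theorem lintegral_rpow_le_of_pMoment_le {p C : ℝ} (hp : 0 < p) (hC : 0 ≤ C) {X : Ω → ℝ}
    (h : pMoment μ p X ≤ ENNReal.ofReal C) :
    ∫⁻ ω, ENNReal.ofReal (|X ω| ^ p) ∂μ ≤ ENNReal.ofReal (C ^ p) := by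
  have := ENNReal.rpow_le_rpow h hp.le
  rwa [pMoment, one_div, ENNReal.rpow_inv_rpow hp.ne', ENNReal.ofReal_rpow_of_nonneg hC hp.le]
    at this

theorem integrable_rpow_of_pMoment_le {p C : ℝ} (hp : 0 < p) (hC : 0 ≤ C) {X : Ω → ℝ}
    (hX : Measurable X) (h : pMoment μ p X ≤ ENNReal.ofReal C) :
    Integrable (fun ω => |X ω| ^ p) μ ∧ ∫ ω, |X ω| ^ p ∂μ ≤ C ^ p := by
  have h1 := lintegral_rpow_le_of_pMoment_le hp hC h
  have hm : Measurable fun ω => |X ω| ^ p := by fun_prop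
  have h0 : ∀ ω, 0 ≤ |X ω| ^ p := fun ω => by positivity
  refine ⟨⟨hm.aestronglyMeasurable, ?_⟩, ?_⟩
  · rw [hasFiniteIntegral_iff_ofReal (ae_of_all _ h0)]
    exact h1.trans_lt ENNReal.ofReal_lt_top
  · rw [integral_eq_lintegral_of_nonneg_ae (ae_of_all _ h0) hm.aestronglyMeasurable]
    exact ENNReal.toReal_le_of_le_ofReal (by positivity) h1

theorem pMoment_mono_exponent [IsProbabilityMeasure μ] {p δ : ℝ} (hp : 0 < p) (hδ : p ≤ δ)
    {X : Ω → ℝ} (hX : Measurable X) : pMoment μ p X ≤ pMoment μ δ X := by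
  rw [pMoment_eq_eLpNorm' μ hp.le, pMoment_eq_eLpNorm' μ (by linarith)]
  exact eLpNorm'_le_eLpNorm'_of_exponent_le hp hδ μ hX.aestronglyMeasurable

variable {N T : ℕ}

/-- The power mean inequality with exponent `p / 2` within a row, and the maximum over rows bounded
by the sum. -/
theorem maxRowNorm_rpow_le (M : Matrix (Fin N) (Fin T) ℝ) {p : ℝ} (hp : 2 ≤ p) :
    maxRowNorm M ^ p ≤ ∑ i, (T : ℝ) ^ (p / 2 - 1) * ∑ t, |M i t| ^ p := by
  have hrow : ∀ i, ‖WithLp.toLp 2 (M i)‖ ^ p ≤ (T : ℝ) ^ (p / 2 - 1) * ∑ t, |M i t| ^ p := by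
    intro i
    have h1 := Real.rpow_sum_le_const_mul_sum_rpow (Finset.univ : Finset (Fin T))
      (fun t => M i t ^ 2) (p := p / 2) (by linarith)
    have e1 : ‖WithLp.toLp 2 (M i)‖ ^ p = (∑ t, |M i t ^ 2|) ^ (p / 2) := by
      have : ‖WithLp.toLp 2 (M i)‖ ^ 2 = ∑ t, |M i t ^ 2| := by
        simp [EuclideanSpace.norm_sq_eq]
      rw [← this, ← Real.rpow_natCast, ← Real.rpow_mul (norm_nonneg _)]
      congr 1; push_cast; ring
    have e2 : ∀ t, |M i t ^ 2| ^ (p / 2) = |M i t| ^ p := fun t => by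
      rw [abs_pow, ← Real.rpow_natCast, ← Real.rpow_mul (abs_nonneg _)]
      congr 1; push_cast; ring
    rw [e1]
    simp only [e2, Finset.card_univ, Fintype.card_fin] at h1
    exact h1
  rcases isEmpty_or_nonempty (Fin N) with hN | hN
  · have : maxRowNorm M = 0 := by simp [maxRowNorm]
    rw [this, Real.zero_rpow (by linarith)]
    simp
  · obtain ⟨i, hi⟩ := exists_eq_ciSup_of_finite (f := fun i => ‖WithLp.toLp 2 (M i)‖)
    have : maxRowNorm M = ‖WithLp.toLp 2 (M i)‖ := hi.symm
    rw [this]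
    refine (hrow i).trans ?_
    exact Finset.single_le_sum
      (f := fun i => (T : ℝ) ^ (p / 2 - 1) * ∑ t, |M i t| ^ p)
      (fun _ _ => by positivity) (Finset.mem_univ i)

theorem lintegral_maxRowNorm_rpow_le {A : Ω → Matrix (Fin N) (Fin T) ℝ} {p C : ℝ} (hp : 2 ≤ p)
    (hC : 0 ≤ C) (hA : ∀ i t, Measurable fun ω => A ω i t)
    (h : ∀ i t, pMoment μ p (fun ω => A ω i t) ≤ ENNReal.ofReal C) :
    ∫⁻ ω, ENNReal.ofReal (maxRowNorm (A ω) ^ p) ∂μ ≤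
      ENNReal.ofReal (N * ((T : ℝ) ^ (p / 2 - 1) * (T * C ^ p))) := by
  have hm : ∀ i t, Measurable fun ω => ENNReal.ofReal (|A ω i t| ^ p) := fun i t => by
    have := hA i t
    fun_prop
  calc _ ≤ ∫⁻ ω, ∑ i, ENNReal.ofReal ((T : ℝ) ^ (p / 2 - 1)) *
        ∑ t, ENNReal.ofReal (|A ω i t| ^ p) ∂μ := by
        refine lintegral_mono fun ω => ?_
        refine (ENNReal.ofReal_le_ofReal (maxRowNorm_rpow_le (A ω) hp)).trans (le_of_eq ?_)
        rw [ENNReal.ofReal_sum_of_nonneg fun _ _ => by positivity]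
        refine Finset.sum_congr rfl fun i _ => ?_
        rw [ENNReal.ofReal_mul (by positivity),
          ENNReal.ofReal_sum_of_nonneg fun _ _ => by positivity]
    _ = ∑ i, ENNReal.ofReal ((T : ℝ) ^ (p / 2 - 1)) *
        ∑ t, ∫⁻ ω, ENNReal.ofReal (|A ω i t| ^ p) ∂μ := by
        rw [lintegral_finsetSum _ fun i _ =>
          (Finset.measurable_sum _ fun t _ => hm i t).const_mul _]
        refine Finset.sum_congr rfl fun i _ => ?_
        rw [lintegral_const_mul' _ _ ENNReal.ofReal_ne_top,
          lintegral_finsetSum _ fun t _ => hm i t]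
    _ ≤ ∑ _i : Fin N, ENNReal.ofReal ((T : ℝ) ^ (p / 2 - 1)) *
        ∑ _t : Fin T, ENNReal.ofReal (C ^ p) := by
        gcongr with i _ t _
        exact lintegral_rpow_le_of_pMoment_le (by linarith) hC (h i t)
    _ = _ := by
        rw [ENNReal.ofReal_mul (by positivity), ENNReal.ofReal_mul (by positivity),
          ENNReal.ofReal_mul (by positivity)]
        simp

theorem pMoment_maxRowNorm_lt_top {A : Ω → Matrix (Fin N) (Fin T) ℝ} {p C : ℝ} (hp : 2 ≤ p)
    (hC : 0 ≤ C) (hA : ∀ i t, Measurable fun ω => A ω i t)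
    (h : ∀ i t, pMoment μ p (fun ω => A ω i t) ≤ ENNReal.ofReal C) :
    pMoment μ p (fun ω => maxRowNorm (A ω)) < ⊤ := by
  have h1 := (lintegral_maxRowNorm_rpow_le hp hC hA h).trans_lt ENNReal.ofReal_lt_top
  unfold pMoment
  simp only [abs_of_nonneg (maxRowNorm_nonneg _)]
  exact ENNReal.rpow_lt_top_of_nonneg (by positivity) h1.ne

theorem pMoment_maxRowNorm_le {A : Ω → Matrix (Fin N) (Fin T) ℝ} {p C : ℝ} (hT : 1 ≤ T)
    (hp : 2 ≤ p) (hC : 0 ≤ C) (hA : ∀ i t, Measurable fun ω => A ω i t)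
    (h : ∀ i t, pMoment μ p (fun ω => A ω i t) ≤ ENNReal.ofReal C) :
    pMoment μ p (fun ω => maxRowNorm (A ω)) ≤
      ENNReal.ofReal (C * ((N : ℝ) ^ (1 / p) * (T : ℝ) ^ (1 / 2 : ℝ))) := by
  have hp0 : 0 < p := by linarith
  have hT0 : (0 : ℝ) < T := by positivity
  have h1 := ENNReal.rpow_le_rpow (lintegral_maxRowNorm_rpow_le hp hC hA h)
    (by positivity : 0 ≤ 1 / p)
  unfold pMoment
  simp only [abs_of_nonneg (maxRowNorm_nonneg _)]
  refine h1.trans (le_of_eq ?_)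
  rw [ENNReal.ofReal_rpow_of_nonneg (by positivity) (by positivity)]
  congr 1
  have e : (N : ℝ) * ((T : ℝ) ^ (p / 2 - 1) * (T * C ^ p)) = N * ((T : ℝ) ^ (p / 2) * C ^ p) := by
    rw [← mul_assoc ((T : ℝ) ^ _)]
    congr 2
    nth_rw 2 [← Real.rpow_one (T : ℝ)]
    rw [← Real.rpow_add hT0, sub_add_cancel]
  rw [e, Real.mul_rpow (by positivity) (by positivity),
    Real.mul_rpow (by positivity) (by positivity), ← Real.rpow_mul hT0.le, ← Real.rpow_mul hC]
  have e2 : p / 2 * (1 / p) = 1 / 2 := by field_simp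
  have e3 : p * (1 / p) = 1 := by field_simp
  rw [e2, e3, Real.rpow_one]
  ring

/-- Needs no lower bound on the dimensions, so it covers every `k`, not only large ones. -/
theorem pMoment_norm_lt_top {A : Ω → Matrix (Fin N) (Fin T) ℝ} {p C : ℝ} (hp : 2 ≤ p)
    (hC : 0 ≤ C) (hA : ∀ i t, Measurable fun ω => A ω i t)
    (h : ∀ i t, pMoment μ p (fun ω => A ω i t) ≤ ENNReal.ofReal C) :
    pMoment μ p (fun ω => ‖A ω‖) < ⊤ := by
  have hg : Measurable fun (ω : Ω) (i : Fin N) => (A ω i : Fin T → ℝ) :=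
    measurable_pi_lambda _ fun i => measurable_pi_lambda _ fun t => hA i t
  have e1 := pMoment_map (p := p) (μ := μ) hg
    (continuous_norm_matrix (N := N) (T := T)).measurable
  have e2 := pMoment_map (p := p) (μ := μ) hg (measurable_maxRowNorm (N := N) (T := T))
  change _ = pMoment μ p (fun ω => ‖A ω‖) at e1
  change _ = pMoment μ p (fun ω => maxRowNorm (A ω)) at e2
  have h1 := pMoment_maxRowNorm_lt_top hp hC hA h
  rw [← e1]
  rw [← e2] at h1
  rw [pMoment_eq_eLpNorm' _ (by linarith)] at h1 ⊢
  exact eLpNorm'_norm_lt_top (by linarith) h1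

end Rows

/-! ### Autocovariances of mixing rows and the norm of `Σ` -/

section Mixing

variable {Ω : Type*} [MeasurableSpace Ω] {μ : Measure Ω} [IsProbabilityMeasure μ] {T : ℕ}

theorem abs_sub_le_alphaMixingCoeff (X : Fin T → Ω → ℝ) {s t : Fin T} {q : ℕ}
    (hst : (t : ℕ) = s + q) {B C : Set Ω}
    (hB : MeasurableSet[MeasurableSpace.comap (X s) inferInstance] B)
    (hC : MeasurableSet[MeasurableSpace.comap (X t) inferInstance] C) :
    |μ.real (B ∩ C) - μ.real B * μ.real C| ≤ alphaMixingCoeff μ X q := by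
  refine le_csSup (bddAbove_alphaMixingSet μ X q) ⟨s, t, B, C, hst, ?_, ?_, rfl⟩
  · exact le_iSup (fun r : {r : Fin T // r ≤ s} => MeasurableSpace.comap (X r) inferInstance)
      ⟨s, le_rfl⟩ B hB
  · exact le_iSup (fun r : {r : Fin T // t ≤ r} => MeasurableSpace.comap (X r) inferInstance)
      ⟨t, le_rfl⟩ C hC

/-- The bound on the autocovariances at lag `q`. -/
noncomputable def lagBound (C c δ φ : ℝ) (q : ℕ) : ℝ :=
  if q = 0 then 1 + C ^ δ else 4 * (c + 1) * C ^ 2 * (q : ℝ) ^ (-(φ * (δ - 2) / δ))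

theorem abs_integral_mul_le_lagBound {X : Fin T → Ω → ℝ} (hX : ∀ t, Measurable (X t))
    {δ C c φ : ℝ} (hδ : 2 < δ) (hC : 1 ≤ C)
    (hmom : ∀ t, pMoment μ δ (X t) ≤ ENNReal.ofReal C) (h0 : ∀ t, ∫ ω, X t ω ∂μ = 0)
    (hmix : ∀ q : ℕ, 1 ≤ q → alphaMixingCoeff μ X q ≤ c * (q : ℝ) ^ (-φ)) (s t : Fin T) :
    |∫ ω, X s ω * X t ω ∂μ| ≤ lagBound C c δ φ (Nat.dist s t) := by
  have hi := fun t => integrable_rpow_of_pMoment_le (by linarith : 0 < δ) (by linarith) (hX t)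
    (hmom t)
  have main : ∀ s t : Fin T, s < t →
      |∫ ω, X s ω * X t ω ∂μ| ≤ lagBound C c δ φ (Nat.dist s t) := by
    intro s t hst
    have hst' : (s : ℕ) < t := hst
    set q := Nat.dist s t with hq
    have hq1 : (t : ℕ) = s + q := by rw [hq, Nat.dist]; omega
    have hq0 : 1 ≤ q := by omega
    have hqR : (0 : ℝ) < q := by positivity
    -- This truncation level balances the mixing term `q^{-φ} M²` against the tail term `C^δ
    -- M^{2-δ}`: both become multiples of `C² q^{-φ(δ-2)/δ}`.
    have hM : 0 < C * (q : ℝ) ^ (φ / δ) := by positivity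
    have h := abs_integral_mul_le_of_moment (μ := μ) (hX s) (hX t) hM hδ.le (hi s).1 (hi t).1
      (hi s).2 (hi t).2 (h0 s) (a := c * (q : ℝ) ^ (-φ)) fun B C hB hC =>
        (abs_sub_le_alphaMixingCoeff X hq1 hB hC).trans (hmix q hq0)
    refine h.trans (le_of_eq ?_)
    have hδ0 : δ ≠ 0 := by linarith
    rw [lagBound, if_neg (by omega), Real.mul_rpow (by linarith) (by positivity),
      ← Real.rpow_mul hqR.le, mul_pow, ← Real.rpow_natCast ((q : ℝ) ^ (φ / δ)),
      ← Real.rpow_mul hqR.le]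
    have e1 : (q : ℝ) ^ (-φ) * (q : ℝ) ^ (φ / δ * (2 : ℕ)) = (q : ℝ) ^ (-(φ * (δ - 2) / δ)) := by
      rw [← Real.rpow_add hqR]; congr 1; push_cast; field_simp; ring
    have e2 : C ^ δ * C ^ (2 - δ) = C ^ 2 := by
      rw [← Real.rpow_add (by linarith), ← Real.rpow_two]; congr 1; ring
    have e3 : φ / δ * (2 - δ) = -(φ * (δ - 2) / δ) := by field_simp; ring
    rw [e3]
    linear_combination 4 * c * C ^ 2 * e1 + 4 * (q : ℝ) ^ (-(φ * (δ - 2) / δ)) * e2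
  rcases lt_trichotomy s t with h | h | h
  · exact main s t h
  · subst h
    rw [Nat.dist_self, lagBound, if_pos rfl]
    -- Mixing says nothing at lag 0; there `x² ≤ 1 + |x|^δ` suffices.
    have hpt : ∀ ω, ‖X s ω * X s ω‖ ≤ 1 + |X s ω| ^ δ := fun ω => by
      rw [norm_mul, Real.norm_eq_abs, ← sq, ← Real.rpow_two]
      rcases le_total |X s ω| 1 with h | h
      · have h1 := Real.rpow_le_one (abs_nonneg _) h zero_le_two
        have h2 : 0 ≤ |X s ω| ^ δ := by positivity
        linarith
      · have := Real.rpow_le_rpow_of_exponent_le h hδ.le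
        linarith
    have := norm_integral_le_of_norm_le ((integrable_const 1).add (hi s).1) (ae_of_all μ hpt)
    rw [Real.norm_eq_abs] at this
    refine this.trans ?_
    simp only [Pi.add_apply]
    rw [integral_add (integrable_const _) (hi s).1]
    simpa using (hi s).2
  · have := main t s h
    rw [Nat.dist_comm]
    simpa only [mul_comm] using this

theorem lagBound_nonneg {C c δ φ : ℝ} (hC : 0 ≤ C) (hc : 0 ≤ c) (q : ℕ) :
    0 ≤ lagBound C c δ φ q := by
  unfold lagBound
  split_ifs <;> positivity

theorem summable_lagBound {C c δ φ : ℝ} (hδ : 2 < δ) (hφ : δ / (δ - 2) < φ) :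
    Summable (lagBound C c δ φ) := by
  have hs : Summable fun q : ℕ =>
      4 * (c + 1) * C ^ 2 * (q : ℝ) ^ (-(φ * (δ - 2) / δ)) := by
    refine Summable.mul_left _ (Real.summable_nat_rpow.2 ?_)
    rw [div_lt_iff₀ (by linarith)] at hφ
    rw [neg_lt_neg_iff, lt_div_iff₀ (by linarith)]
    linarith
  refine (summable_congr_cofinite ?_).1 hs
  rw [Nat.cofinite_eq_atTop]
  filter_upwards [eventually_ge_atTop 1] with q hq
  rw [lagBound, if_neg (by omega)]

theorem norm_secondMomentMatrix_le {N : ℕ} (hN : 1 ≤ N) {A : Ω → Matrix (Fin N) (Fin T) ℝ}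
    (hA : ∀ i t, Measurable fun ω => A ω i t) {δ C c φ : ℝ} (hδ : 2 < δ) (hC : 1 ≤ C)
    (hc : 0 ≤ c) (hφ : δ / (δ - 2) < φ)
    (hmom : ∀ i t, pMoment μ δ (fun ω => A ω i t) ≤ ENNReal.ofReal C)
    (h0 : ∀ i t, ∫ ω, A ω i t ∂μ = 0)
    (hmix : ∀ i, ∀ q : ℕ, 1 ≤ q →
      alphaMixingCoeff μ (fun t ω => A ω i t) q ≤ c * (q : ℝ) ^ (-φ)) :
    ‖secondMomentMatrix μ A‖ ≤ 2 * ∑' q, lagBound C c δ φ q := by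
  have hnn : ∀ q, 0 ≤ lagBound C c δ φ q := lagBound_nonneg (by linarith) hc
  refine norm_le_of_row_sum_le (fun s t => ?_) (mul_nonneg zero_le_two (tsum_nonneg hnn))
    fun s => ?_
  · simp only [secondMomentMatrix, Matrix.of_apply, mul_comm]
  · refine le_trans (Finset.sum_le_sum fun t _ => ?_)
      (sum_natDist_le_two_mul_tsum s hnn (summable_lagBound hδ hφ))
    have hN0 : (0 : ℝ) < N := by positivity
    rw [secondMomentMatrix, Matrix.of_apply, abs_mul, abs_of_pos (by positivity), one_div,
      inv_mul_le_iff₀ hN0]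
    refine (Finset.abs_sum_le_sum_abs _ _).trans ?_
    refine (Finset.sum_le_card_nsmul _ _ _ fun i _ =>
      abs_integral_mul_le_lagBound (hA i) hδ hC (hmom i) (h0 i) (hmix i) s t).trans (le_of_eq ?_)
    simp

end Mixing

/-! ### From the moment bound to the rates -/

section Asymptotics

/-- The witnesses `min x u` and `x - min x u` give an exact decomposition for all `k`, although the
bound holds only eventually. -/
theorem exists_isBigO_add_of_le_add {x u v : ℕ → ℝ} (hx : ∀ k, 0 ≤ x k) (hu : ∀ k, 0 ≤ u k)
    (hv : ∀ k, 0 ≤ v k) (h : ∀ᶠ k in atTop, x k ≤ u k + v k) :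
    ∃ f g : ℕ → ℝ, (∀ k, x k = f k + g k) ∧ f =O[atTop] u ∧ g =O[atTop] v := by
  refine ⟨fun k => min (x k) (u k), fun k => x k - min (x k) (u k), fun k => by ring, ?_, ?_⟩
  · refine IsBigO.of_bound 1 (Eventually.of_forall fun k => ?_)
    rw [Real.norm_of_nonneg (le_min (hx k) (hu k)), Real.norm_of_nonneg (hu k), one_mul]
    exact min_le_right _ _
  · refine IsBigO.of_bound 1 (h.mono fun k hk => ?_)
    rw [Real.norm_of_nonneg (sub_nonneg.2 (min_le_left _ _)), one_mul]
    refine le_trans ?_ (le_abs_self _)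
    rcases le_total (x k) (u k) with h1 | h1
    · rw [min_eq_left h1, sub_self]; exact hv k
    · rw [min_eq_right h1]; linarith

theorem pMoment_norm_toReal_le {Ω : Type*} [MeasurableSpace Ω] {μ : Measure Ω}
    [IsProbabilityMeasure μ] {N T : ℕ} (hN : 1 ≤ N) (hT : 3 ≤ T)
    {A : Ω → Matrix (Fin N) (Fin T) ℝ} (hA : ∀ i t, Measurable fun ω => A ω i t)
    (hind : iIndepFun (fun (i : Fin N) (ω : Ω) => (A ω i : Fin T → ℝ)) μ)
    {p C S b r : ℝ} (hp : 2 ≤ p) (hC : 0 ≤ C)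
    (hmom : ∀ i t, pMoment μ p (fun ω => A ω i t) ≤ ENNReal.ofReal C)
    (hS : ‖secondMomentMatrix μ A‖ ≤ S) (hr : 0 ≤ r) (hNT : (N : ℝ) ≤ r * (T : ℝ) ^ b) :
    (pMoment μ p (fun ω => ‖A ω‖)).toReal ≤
      Real.sqrt r * S ^ (1 / 2 : ℝ) * (T : ℝ) ^ (b / 2) +
      8 * Real.sqrt (p + 1) * C * r ^ (1 / p) *
        (Real.sqrt (Real.log T) * (T : ℝ) ^ (1 / 2 + b / p)) := by
  have hT0 : (0 : ℝ) < T := by positivity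
  -- Here `T ≥ 3 > e` matters: `log T ≥ 1` gives `p + log T ≤ (p + 1) log T`.
  have hlog : 1 ≤ Real.log T := by
    rw [Real.le_log_iff_exp_le hT0]
    have h3 : (3 : ℝ) ≤ T := by exact_mod_cast hT
    linarith [Real.exp_one_lt_d9]
  have h1 := pMoment_norm_le hN (by omega) μ A hA hind hp
  have h2 := h1.trans (add_le_add_right (mul_le_mul_right
    (pMoment_maxRowNorm_le (by omega) hp hC hA hmom) _) _)
  rw [← ENNReal.ofReal_mul (by positivity), ← ENNReal.ofReal_add (by positivity) (by positivity)]
    at h2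
  refine (ENNReal.toReal_le_of_le_ofReal (by positivity) h2).trans (add_le_add ?_ ?_)
  · have e1 : Real.sqrt N ≤ Real.sqrt r * (T : ℝ) ^ (b / 2) := by
      refine (Real.sqrt_le_sqrt hNT).trans (le_of_eq ?_)
      rw [Real.sqrt_mul hr, Real.sqrt_eq_rpow ((T : ℝ) ^ b), ← Real.rpow_mul hT0.le]
      congr 2; ring
    have e2 : ‖secondMomentMatrix μ A‖ ^ (1 / 2 : ℝ) ≤ S ^ (1 / 2 : ℝ) :=
      Real.rpow_le_rpow (norm_nonneg _) hS (by norm_num)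
    refine (mul_le_mul e1 e2 (by positivity) (by positivity)).trans (le_of_eq (by ring))
  · have e1 : (N : ℝ) ^ (1 / p) ≤ r ^ (1 / p) * (T : ℝ) ^ (b / p) := by
      refine (Real.rpow_le_rpow (by positivity) hNT (by positivity)).trans (le_of_eq ?_)
      rw [Real.mul_rpow hr (by positivity), ← Real.rpow_mul hT0.le]
      congr 2; ring
    have e2 : Real.sqrt (p + Real.log T) ≤ Real.sqrt (p + 1) * Real.sqrt (Real.log T) := by
      rw [← Real.sqrt_mul (by linarith)]
      exact Real.sqrt_le_sqrt (by nlinarith)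
    rw [Real.rpow_add hT0]
    calc _ ≤ 8 * (Real.sqrt (p + 1) * Real.sqrt (Real.log T)) *
          (C * (r ^ (1 / p) * (T : ℝ) ^ (b / p) * (T : ℝ) ^ (1 / 2 : ℝ))) := by gcongr
      _ = _ := by ring

end Asymptotics

theorem mainTheorem8 :
    -- the nonasymptotic bound
    (∃ C₁ C₂ : ℝ, 0 < C₁ ∧ 0 < C₂ ∧
      ∀ (N T : ℕ), 1 ≤ N → 1 ≤ T →
      ∀ (Ω : Type u) [MeasurableSpace Ω] (μ : Measure Ω) [IsProbabilityMeasure μ]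
        (A : Ω → Matrix (Fin N) (Fin T) ℝ),
        (∀ i t, Measurable fun ω => A ω i t) →
        iIndepFun (fun (i : Fin N) (ω : Ω) => (A ω i : Fin T → ℝ)) μ →
        ∀ p : ℝ, 2 ≤ p →
          pMoment μ p (fun ω => ‖A ω‖) ≤
            ENNReal.ofReal (C₁ * Real.sqrt N * ‖secondMomentMatrix μ A‖ ^ (1 / 2 : ℝ)) +
            ENNReal.ofReal (C₂ * Real.sqrt (p + Real.log T)) *
              pMoment μ p (fun ω => maxRowNorm (A ω))) ∧
    -- the asymptotic bound, along sequences with `N, T → ∞`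
    (∀ (p δ C₁ C₂ C₃ φ b : ℝ), 2 ≤ p → p < δ → 0 < C₃ → δ / (δ - 2) < φ → 0 < b →
      ∀ (N T : ℕ → ℕ), Tendsto N atTop atTop → Tendsto T atTop atTop →
      Tendsto (fun k => (N k : ℝ) / (T k : ℝ) ^ b) atTop (nhds C₃) →
      ∀ (Ω : ℕ → Type u) [∀ k, MeasurableSpace (Ω k)] (μ : ∀ k, Measure (Ω k))
        [∀ k, IsProbabilityMeasure (μ k)]
        (A : ∀ k, Ω k → Matrix (Fin (N k)) (Fin (T k)) ℝ),
        (∀ k i t, Measurable fun ω => A k ω i t) →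
        (∀ k, iIndepFun (fun (i : Fin (N k)) (ω : Ω k) => (A k ω i : Fin (T k) → ℝ)) (μ k)) →
        (∀ k i t, pMoment (μ k) δ (fun ω => A k ω i t) ≤ ENNReal.ofReal C₁) →
        (∀ k i t, ∫ ω, A k ω i t ∂(μ k) = 0) →
        (∀ k i, ∀ q : ℕ, 1 ≤ q →
          alphaMixingCoeff (μ k) (fun t ω => A k ω i t) q ≤ C₂ * (q : ℝ) ^ (-φ)) →
        (∀ k, pMoment (μ k) p (fun ω => ‖A k ω‖) < ⊤) ∧
        ∃ f g : ℕ → ℝ,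
          (∀ k, (pMoment (μ k) p (fun ω => ‖A k ω‖)).toReal = f k + g k) ∧
          f =O[atTop] (fun k => (T k : ℝ) ^ (b / 2)) ∧
          g =O[atTop] (fun k => Real.sqrt (Real.log (T k)) * (T k : ℝ) ^ (1 / 2 + b / p))) := by
  refine ⟨⟨1, 8, one_pos, by norm_num, ?_⟩, ?_⟩
  · intro N T hN hT Ω _ μ _ A hA hind p hp
    rw [one_mul]
    exact pMoment_norm_le hN hT μ A hA hind hp
  · intro p δ C₁ C₂ C₃ φ b hp hδ hC₃ hφ hb N T hN hT hNT Ω _ μ _ A hA hind hmom h0 hmix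
    -- Enlarging the constants to `C ≥ 1` and `c ≥ 0` loses nothing and avoids sign cases.
    set C := max C₁ 1
    set c := max C₂ 0
    have hC : 1 ≤ C := le_max_right _ _
    have hmomδ : ∀ k i t, pMoment (μ k) δ (fun ω => A k ω i t) ≤ ENNReal.ofReal C :=
      fun k i t => (hmom k i t).trans (ENNReal.ofReal_le_ofReal (le_max_left _ _))
    have hmomp : ∀ k i t, pMoment (μ k) p (fun ω => A k ω i t) ≤ ENNReal.ofReal C :=
      fun k i t => (pMoment_mono_exponent (by linarith) hδ.le (hA k i t)).trans (hmomδ k i t)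
    have hmix' : ∀ k i, ∀ q : ℕ, 1 ≤ q →
        alphaMixingCoeff (μ k) (fun t ω => A k ω i t) q ≤ c * (q : ℝ) ^ (-φ) := fun k i q hq =>
      (hmix k i q hq).trans (mul_le_mul_of_nonneg_right (le_max_left _ _) (by positivity))
    refine ⟨fun k => pMoment_norm_lt_top hp (by linarith) (hA k) (hmomp k), ?_⟩
    set S := 2 * ∑' q, lagBound C c δ φ q
    set u : ℕ → ℝ := fun k => Real.sqrt (C₃ + 1) * S ^ (1 / 2 : ℝ) * (T k : ℝ) ^ (b / 2) with hu
    set v : ℕ → ℝ := fun k => 8 * Real.sqrt (p + 1) * C * (C₃ + 1) ^ (1 / p) *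
      (Real.sqrt (Real.log (T k)) * (T k : ℝ) ^ (1 / 2 + b / p)) with hv
    have hS : 0 ≤ S := mul_nonneg zero_le_two
      (tsum_nonneg (lagBound_nonneg (by linarith) (le_max_right _ _)))
    have hC0 : 0 ≤ C := by linarith
    have key : ∀ᶠ k in atTop, (pMoment (μ k) p (fun ω => ‖A k ω‖)).toReal ≤ u k + v k := by
      -- Eventually `N k < (C₃ + 1) (T k)^b`, so the implied constants do not depend on `k`.
      filter_upwards [hN.eventually_ge_atTop 1, hT.eventually_ge_atTop 3,
        hNT.eventually (gt_mem_nhds (lt_add_one C₃))] with k hNk hTk hk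
      have hTb : (0 : ℝ) < (T k : ℝ) ^ b := by
        have : (0 : ℝ) < T k := by positivity
        positivity
      exact pMoment_norm_toReal_le hNk hTk (hA k) (hind k) hp hC0 (hmomp k)
        (norm_secondMomentMatrix_le hNk (hA k) (by linarith) hC (le_max_right _ _) hφ
          (hmomδ k) (h0 k) (hmix' k)) (by linarith) ((div_lt_iff₀ hTb).1 hk).le
    obtain ⟨f, g, hfg, hf, hg⟩ := exists_isBigO_add_of_le_add
      (fun k => ENNReal.toReal_nonneg) (fun k => by positivity) (fun k => by positivity) key
    exact ⟨f, g, hfg, hf.trans (isBigO_const_mul_self _ _ _),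
      hg.trans (isBigO_const_mul_self _ _ _)⟩
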